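/- Let $(Q,\mathfrak m,\mathsf k)$ be a commutative Noetherian local ring with $\mathrm{char}(\mathsf k)=0$. Let $f,g\in Q$ be nonzero elements with $\mathrm{ann}_Q(f)=(g)$ and $\mathrm{ann}_Q(g)=(f)$ (that is, $(f,g)$ is an exact pair of zero divisors), and assume $f\in\mathfrak m\smallsetminus\mathfrak m^2$. Set $R=Q/(f)$, and let $M$, $N$ be finitely generated $R$-modules such that $\mathfrak m^2N=0=gN$. Let $\nu_N\colon\mathfrak mN\to N$ denote the inclusion. If the induced maps $\mathrm{Tor}^R_i(M,\nu_N)\colon \mathrm{Tor}^R_i(M,\mathfrak mN)\to\mathrm{Tor}^R_i(M,N)$ are zero for all $i\ge 0$, then the induced maps $\mathrm{Tor}^Q_i(M,\nu_N)\colon \mathrm{Tor}^Q_i(M,\mathfrak mN)\to\mathrm{Tor}^Q_i(M,N)$ are zero for all $i\ge 0$. Moreover, under the same hypotheses, the modules $\mathrm{Tor}^Q_i(M,N)$ and $\mathrm{Tor}^R_i(M,N)$ have finite length for all $i\ge 0$, and the generalized Poincaré series $P^A_{M,N}(t)=\sum_{i\ge 0}\ell_A(\mathrm{Tor}^A_i(M,N))\,t^i$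 (for $A=Q,R$, where $\ell_A$ denotes length over $A$) satisfy $$P^Q_{M,N}(t)=\frac{P^R_{M,N}(t)}{1-t}.$$ -/

import Mathlib

open CategoryTheory

universe u

noncomputable section

/-- `(f, g)` is an exact pair of zero divisors: `f` and `g` are nonzero, `ann (f) = (g)` and
`ann (g) = (f)`. -/
def IsExactPair {Q : Type u} [CommRing Q] (f g : Q) : Prop :=
  f ≠ 0 ∧ g ≠ 0 ∧
    (Ideal.span {f}).annihilator = Ideal.span {g} ∧
    (Ideal.span {g}).annihilator = Ideal.span {f}

/-- `Tor_i^A(M, N)`, the `i`-th left derived functor of `- ⊗ N` evaluated at `M`: the homology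
`H_i(U ⊗ N)` for a projective resolution `U` of `M` over `A`. -/
abbrev TorModule (A : Type u) [CommRing A] (i : ℕ) (M N : Type u)
    [AddCommGroup M] [Module A M] [AddCommGroup N] [Module A N] : ModuleCat.{u} A :=
  ((Tor' (ModuleCat.{u} A) i).obj (ModuleCat.of A M)).obj (ModuleCat.of A N)

/-- The map `Tor_i^A(M, φ) : Tor_i^A(M, N) ⟶ Tor_i^A(M, N')` induced by an `A`-linear map
`φ : N → N'`, that is, `H_i(U ⊗ φ)` for a projective resolution `U` of `M` over `A`. -/
def torMap (A : Type u) [CommRing A] (i : ℕ) (M : Type u) {N N' : Type u}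
    [AddCommGroup M] [Module A M] [AddCommGroup N] [Module A N] [AddCommGroup N'] [Module A N']
    (φ : N →ₗ[A] N') : TorModule A i M N ⟶ TorModule A i M N' :=
  ((Tor' (ModuleCat.{u} A) i).obj (ModuleCat.of A M)).map (ModuleCat.ofHom φ)

/-- The inclusion `I N → N`, as an `A`-linear map, for an ideal `I` of `A`. -/
def idealInclusion {A : Type u} [CommRing A] (I : Ideal A) (N : Type u)
    [AddCommGroup N] [Module A N] : ↥(I • (⊤ : Submodule A N)) →ₗ[A] N :=
  (I • (⊤ : Submodule A N)).subtype

/-- The generalized Poincaré series `∑ i, ℓ_A(Tor_i^A(M, N)) t ^ i`. It is meaningful when all the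
lengths are finite. -/
def poincareSeries (A : Type u) [CommRing A] (M N : Type u)
    [AddCommGroup M] [Module A M] [AddCommGroup N] [Module A N] : PowerSeries ℚ :=
  PowerSeries.mk fun i => ((Module.length A (TorModule A i M N)).toNat : ℚ)

end

/-! Write `R = Q/(f)`, `k` for the residue field, and choose a minimal presentation `0 → K → Rⁿ → M
→ 0`, so that `K ⊆ 𝔪 Rⁿ`. As `f` and `g` kill `N`, the sequences `0 → Q/(g) → Q → Q/(f) → 0` and the
same with `f`, `g` exchanged give `Tor^Q_i(Rⁿ, N) ≅ Nⁿ` in every degree (`torEquiv`). Everything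
rests on one fact, `mem_range_mapLeft_kerInclusion_iff`: in every degree the image of `Tor^Q_i(K,
N)` in `Nⁿ` is exactly `(𝔪N)ⁿ`.

The image contains `(𝔪N)ⁿ`: the hypothesis in degree zero puts `(𝔪N)ⁿ` inside the image of `K ⊗ N`,
and a matrix over `Q` lifting generators of `K` acts in the same way on every `Tor_i`. The image is
not larger: for `V = N/𝔪N` the map `Tor^Q_i(K, V) → Tor^Q_i(Rⁿ, V)` is zero. Since `K → Rⁿ → kⁿ` is
zero, it suffices that `Tor^Q_i(R, V) → Tor^Q_i(k, V)` is injective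
(`mapLeft_residueVec_injective`).

This injectivity is proved by induction in steps of two. Degree zero is clear and degree one is `f ∉
𝔪²`. Two connecting maps compare degree `i + 2` with degree `i` through the map `R → Z`, `1 ↦ (g,
0)`, where `Z` is a syzygy module of `𝔪`. If `(g, 0) ∉ 𝔪Z`, some `Z → k` restricts to the residue
map on `R`, and the induction closes. If `(g, 0) ∈ 𝔪Z`, a Koszul complex contains `v`, `u` of
degrees one and two with `∂v = -g`, `∂u = -f v`. Starting from a vanishing power of `u`, and
dividing by positive integers (here characteristic zero enters), one descends to `1 = ∂a + f b`,
which is absurd (`not_differential_eq`).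

Finally `M` is replaced by `K` and one inducts on the degree. A diagram chase gives the vanishing
over `Q`, and counting lengths in the long exact sequences gives `ℓ Tor^Q_i(M, N) = ∑_{j ≤ i} ℓ
Tor^R_j(M, N)`, which is the identity of power series. -/

noncomputable section

open MonoidalCategory TensorProduct

/-! ### Long exact sequence of Tor in the first variable, with the second variable resolved -/

namespace TorLES

variable {A : Type u} [CommRing A]

/-- The complex `M ⊗ P`. -/
abbrev tensorComplex (M : ModuleCat.{u} A) (P : ChainComplex (ModuleCat.{u} A) ℕ) :
    ChainComplex (ModuleCat.{u} A) ℕ :=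
  (((tensoringLeft (ModuleCat.{u} A)).obj M).mapHomologicalComplex (ComplexShape.down ℕ)).obj P

/-- The map `M ⊗ P ⟶ M' ⊗ P` induced by `M ⟶ M'`. -/
abbrev tensorComplexMapLeft {M M' : ModuleCat.{u} A} (f : M ⟶ M')
    (P : ChainComplex (ModuleCat.{u} A) ℕ) : tensorComplex M P ⟶ tensorComplex M' P :=
  (NatTrans.mapHomologicalComplex ((tensoringLeft (ModuleCat.{u} A)).map f)
    (ComplexShape.down ℕ)).app P

/-- The map `M ⊗ P ⟶ M ⊗ P'` induced by `P ⟶ P'`. -/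
abbrev tensorComplexMapRight (M : ModuleCat.{u} A) {P P' : ChainComplex (ModuleCat.{u} A) ℕ}
    (φ : P ⟶ P') : tensorComplex M P ⟶ tensorComplex M P' :=
  (((tensoringLeft (ModuleCat.{u} A)).obj M).mapHomologicalComplex (ComplexShape.down ℕ)).map φ

/-- The short complex of complexes obtained from a short complex of modules by tensoring with a
complex. -/
@[simps]
def tensorShortComplex (S : ShortComplex (ModuleCat.{u} A))
    (P : ChainComplex (ModuleCat.{u} A) ℕ) :
    ShortComplex (ChainComplex (ModuleCat.{u} A) ℕ) where
  X₁ := tensorComplex S.X₁ P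
  X₂ := tensorComplex S.X₂ P
  X₃ := tensorComplex S.X₃ P
  f := tensorComplexMapLeft S.f P
  g := tensorComplexMapLeft S.g P
  zero := by
    ext n : 1
    change S.f ▷ P.X n ≫ S.g ▷ P.X n = 0
    rw [← comp_whiskerRight, S.zero, MonoidalPreadditive.zero_whiskerRight]

lemma flat_of_projective (P : ModuleCat.{u} A) [Projective P] : Module.Flat A P := by
  have : Module.Projective A P := (IsProjective.iff_projective (R := A) (P := P)).2 ‹_›
  infer_instance

/-- The terms of `P` are projective, hence flat, so each degree stays exact. This is why the second
argument is resolved: a short exact sequence in the first argument directly gives one of complexes,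
with natural connecting maps. -/
lemma tensorShortComplex_shortExact {S : ShortComplex (ModuleCat.{u} A)} (hS : S.ShortExact)
    (P : ChainComplex (ModuleCat.{u} A) ℕ) [∀ n, Projective (P.X n)] :
    (tensorShortComplex S P).ShortExact := by
  apply HomologicalComplex.shortExact_of_degreewise_shortExact
  intro n
  have := flat_of_projective (P.X n)
  exact hS.map_of_exact (tensorRight (P.X n))

/-- Morphisms of short complexes induce morphisms after tensoring with a complex. -/
@[simps]
def tensorShortComplexMapLeft {S S' : ShortComplex (ModuleCat.{u} A)} (φ : S ⟶ S')
    (P : ChainComplex (ModuleCat.{u} A) ℕ) : tensorShortComplex S P ⟶ tensorShortComplex S' P where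
  τ₁ := tensorComplexMapLeft φ.τ₁ P
  τ₂ := tensorComplexMapLeft φ.τ₂ P
  τ₃ := tensorComplexMapLeft φ.τ₃ P
  comm₁₂ := by
    ext n : 1
    change φ.τ₁ ▷ P.X n ≫ S'.f ▷ P.X n = S.f ▷ P.X n ≫ φ.τ₂ ▷ P.X n
    rw [← comp_whiskerRight, φ.comm₁₂, comp_whiskerRight]
  comm₂₃ := by
    ext n : 1
    change φ.τ₂ ▷ P.X n ≫ S'.g ▷ P.X n = S.g ▷ P.X n ≫ φ.τ₃ ▷ P.X n
    rw [← comp_whiskerRight, φ.comm₂₃, comp_whiskerRight]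

/-- Morphisms of complexes induce morphisms of short complexes of complexes. -/
@[simps]
def tensorShortComplexMapRight (S : ShortComplex (ModuleCat.{u} A))
    {P P' : ChainComplex (ModuleCat.{u} A) ℕ} (φ : P ⟶ P') :
    tensorShortComplex S P ⟶ tensorShortComplex S P' where
  τ₁ := tensorComplexMapRight S.X₁ φ
  τ₂ := tensorComplexMapRight S.X₂ φ
  τ₃ := tensorComplexMapRight S.X₃ φ
  comm₁₂ := by
    ext n : 1
    exact whisker_exchange S.f (φ.f n)
  comm₂₃ := by
    ext n : 1
    exact whisker_exchange S.g (φ.f n)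

/-- The connecting map for the homology of a tensor product, in the first variable. -/
def homologyδ {S : ShortComplex (ModuleCat.{u} A)} (hS : S.ShortExact)
    (P : ChainComplex (ModuleCat.{u} A) ℕ) [∀ n, Projective (P.X n)] (i : ℕ) :
    (tensorComplex S.X₃ P).homology (i + 1) ⟶ (tensorComplex S.X₁ P).homology i :=
  (tensorShortComplex_shortExact hS P).δ (i + 1) i (by simp)

lemma homologyδ_naturality_left {S S' : ShortComplex (ModuleCat.{u} A)} (hS : S.ShortExact)
    (hS' : S'.ShortExact) (φ : S ⟶ S') (P : ChainComplex (ModuleCat.{u} A) ℕ)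
    [∀ n, Projective (P.X n)] (i : ℕ) :
    homologyδ hS P i ≫ HomologicalComplex.homologyMap (tensorComplexMapLeft φ.τ₁ P) i =
      HomologicalComplex.homologyMap (tensorComplexMapLeft φ.τ₃ P) (i + 1) ≫ homologyδ hS' P i :=
  HomologicalComplex.HomologySequence.δ_naturality (tensorShortComplexMapLeft φ P)
    (tensorShortComplex_shortExact hS _) (tensorShortComplex_shortExact hS' _) (i + 1) i _

lemma homologyδ_naturality_right {S : ShortComplex (ModuleCat.{u} A)} (hS : S.ShortExact)
    {P P' : ChainComplex (ModuleCat.{u} A) ℕ} [∀ n, Projective (P.X n)]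
    [∀ n, Projective (P'.X n)] (φ : P ⟶ P') (i : ℕ) :
    homologyδ hS P i ≫ HomologicalComplex.homologyMap (tensorComplexMapRight S.X₁ φ) i =
      HomologicalComplex.homologyMap (tensorComplexMapRight S.X₃ φ) (i + 1) ≫
        homologyδ hS P' i :=
  HomologicalComplex.HomologySequence.δ_naturality (tensorShortComplexMapRight S φ)
    (tensorShortComplex_shortExact hS _) (tensorShortComplex_shortExact hS _) (i + 1) i _

lemma function_exact_of_exact {S : ShortComplex (ModuleCat.{u} A)} (h : S.Exact) :
    Function.Exact S.f S.g :=
  (ShortComplex.ShortExact.moduleCat_exact_iff_function_exact S).1 h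

lemma homology_exact₁ {S : ShortComplex (ModuleCat.{u} A)} (hS : S.ShortExact)
    (P : ChainComplex (ModuleCat.{u} A) ℕ) [∀ n, Projective (P.X n)] (i : ℕ) :
    Function.Exact (homologyδ hS P i)
      (HomologicalComplex.homologyMap (tensorComplexMapLeft S.f P) i) :=
  function_exact_of_exact
    ((tensorShortComplex_shortExact hS P).homology_exact₁ (i + 1) i (by simp))

lemma homology_exact₂ {S : ShortComplex (ModuleCat.{u} A)} (hS : S.ShortExact)
    (P : ChainComplex (ModuleCat.{u} A) ℕ) [∀ n, Projective (P.X n)] (i : ℕ) :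
    Function.Exact (HomologicalComplex.homologyMap (tensorComplexMapLeft S.f P) i)
      (HomologicalComplex.homologyMap (tensorComplexMapLeft S.g P) i) :=
  function_exact_of_exact ((tensorShortComplex_shortExact hS P).homology_exact₂ i)

lemma homology_exact₃ {S : ShortComplex (ModuleCat.{u} A)} (hS : S.ShortExact)
    (P : ChainComplex (ModuleCat.{u} A) ℕ) [∀ n, Projective (P.X n)] (i : ℕ) :
    Function.Exact (HomologicalComplex.homologyMap (tensorComplexMapLeft S.g P) (i + 1))
      (homologyδ hS P i) :=
  function_exact_of_exact
    ((tensorShortComplex_shortExact hS P).homology_exact₃ (i + 1) i (by simp))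

/-- `Tor` as the left derived functor in the second variable. -/
abbrev torObj (i : ℕ) (M N : ModuleCat.{u} A) : ModuleCat.{u} A :=
  (((tensoringLeft (ModuleCat.{u} A)).obj M).leftDerived i).obj N

/-- Functoriality of `torObj` in the first variable. -/
abbrev torMapLeft (i : ℕ) {M M' : ModuleCat.{u} A} (f : M ⟶ M') (N : ModuleCat.{u} A) :
    torObj i M N ⟶ torObj i M' N :=
  (NatTrans.leftDerived ((tensoringLeft (ModuleCat.{u} A)).map f) i).app N

/-- Functoriality of `torObj` in the second variable. -/
abbrev torMapRight (i : ℕ) (M : ModuleCat.{u} A) {N N' : ModuleCat.{u} A} (φ : N ⟶ N') :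
    torObj i M N ⟶ torObj i M N' :=
  (((tensoringLeft (ModuleCat.{u} A)).obj M).leftDerived i).map φ

/-- `torObj` is computed by the chosen projective resolution of the second argument. -/
def torIso (i : ℕ) (M N : ModuleCat.{u} A) :
    torObj i M N ≅ (tensorComplex M (projectiveResolution N).complex).homology i :=
  (projectiveResolution N).isoLeftDerivedObj ((tensoringLeft (ModuleCat.{u} A)).obj M) i

lemma torIso_naturality_left (i : ℕ) {M M' : ModuleCat.{u} A} (f : M ⟶ M') (N : ModuleCat.{u} A) :
    torMapLeft i f N ≫ (torIso i M' N).hom = (torIso i M N).hom ≫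
      HomologicalComplex.homologyMap (tensorComplexMapLeft f (projectiveResolution N).complex) i := by
  rw [← Iso.eq_comp_inv, Category.assoc]
  exact ProjectiveResolution.leftDerived_app_eq _ (projectiveResolution N) i

/-- A lift of a map to the chosen projective resolutions. -/
abbrev resolutionLift {N N' : ModuleCat.{u} A} (φ : N ⟶ N') :
    (projectiveResolution N).complex ⟶ (projectiveResolution N').complex :=
  ProjectiveResolution.lift φ (projectiveResolution N) (projectiveResolution N')

lemma torIso_naturality_right (i : ℕ) (M : ModuleCat.{u} A) {N N' : ModuleCat.{u} A} (φ : N ⟶ N') :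
    torMapRight i M φ ≫ (torIso i M N').hom = (torIso i M N).hom ≫
      HomologicalComplex.homologyMap (tensorComplexMapRight M (resolutionLift φ)) i :=
  (projectiveResolution N).isoLeftDerivedObj_hom_naturality φ (projectiveResolution N') _
    (ProjectiveResolution.lift_commutes_zero _ _ _) _ i

instance (N : ModuleCat.{u} A) (n : ℕ) : Projective ((projectiveResolution N).complex.X n) :=
  (projectiveResolution N).projective n

/-- The connecting map of `Tor` in the first variable. -/
def torδ {S : ShortComplex (ModuleCat.{u} A)} (hS : S.ShortExact) (N : ModuleCat.{u} A) (i : ℕ) :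
    torObj (i + 1) S.X₃ N ⟶ torObj i S.X₁ N :=
  (torIso (i + 1) S.X₃ N).hom ≫ homologyδ hS (projectiveResolution N).complex i ≫
      (torIso i S.X₁ N).inv

lemma torδ_naturality_left {S S' : ShortComplex (ModuleCat.{u} A)} (hS : S.ShortExact)
    (hS' : S'.ShortExact) (φ : S ⟶ S') (N : ModuleCat.{u} A) (i : ℕ) :
    torδ hS N i ≫ torMapLeft i φ.τ₁ N = torMapLeft (i + 1) φ.τ₃ N ≫ torδ hS' N i := by
  rw [← cancel_mono (torIso i S'.X₁ N).hom]
  simp only [torδ, Category.assoc, Iso.inv_hom_id, Category.comp_id]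
  rw [torIso_naturality_left, Iso.inv_hom_id_assoc, reassoc_of% torIso_naturality_left (i + 1) φ.τ₃,
    homologyδ_naturality_left hS hS']

lemma torδ_naturality_right {S : ShortComplex (ModuleCat.{u} A)} (hS : S.ShortExact)
    {N N' : ModuleCat.{u} A} (φ : N ⟶ N') (i : ℕ) :
    torδ hS N i ≫ torMapRight i S.X₁ φ = torMapRight (i + 1) S.X₃ φ ≫ torδ hS N' i := by
  rw [← cancel_mono (torIso i S.X₁ N').hom]
  simp only [torδ, Category.assoc, Iso.inv_hom_id, Category.comp_id]
  rw [torIso_naturality_right, Iso.inv_hom_id_assoc, reassoc_of% torIso_naturality_right (i + 1) S.X₃ φ,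
    homologyδ_naturality_right hS]

/-- Exactness transports along isomorphisms in `ModuleCat`. -/
lemma exact_of_iso {X Y Z X' Y' Z' : ModuleCat.{u} A} {f : X ⟶ Y} {g : Y ⟶ Z} {f' : X' ⟶ Y'}
    {g' : Y' ⟶ Z'} (a : X ≅ X') (b : Y ≅ Y') (c : Z ≅ Z') (h₁ : f ≫ b.hom = a.hom ≫ f')
    (h₂ : g ≫ c.hom = b.hom ≫ g') (h : Function.Exact f' g') : Function.Exact f g := by
  refine (Function.Exact.iff_of_ladder_linearEquiv (e₁ := a.toLinearEquiv)
    (e₂ := b.toLinearEquiv) (e₃ := c.toLinearEquiv) (f₁₂ := f.hom) (f₂₃ := g.hom)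
    (g₁₂ := f'.hom) (g₂₃ := g'.hom) ?_ ?_).1 h
  · exact (congrArg ModuleCat.Hom.hom h₁).symm
  · exact (congrArg ModuleCat.Hom.hom h₂).symm

lemma tor_exact₁ {S : ShortComplex (ModuleCat.{u} A)} (hS : S.ShortExact) (N : ModuleCat.{u} A)
    (i : ℕ) : Function.Exact (torδ hS N i) (torMapLeft i S.f N) :=
  exact_of_iso (torIso (i + 1) S.X₃ N) (torIso i S.X₁ N) (torIso i S.X₂ N) (by simp [torδ])
    (torIso_naturality_left i S.f N) (homology_exact₁ hS _ i)

lemma tor_exact₂ {S : ShortComplex (ModuleCat.{u} A)} (hS : S.ShortExact) (N : ModuleCat.{u} A)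
    (i : ℕ) : Function.Exact (torMapLeft i S.f N) (torMapLeft i S.g N) :=
  exact_of_iso (torIso i S.X₁ N) (torIso i S.X₂ N) (torIso i S.X₃ N)
    (torIso_naturality_left i S.f N) (torIso_naturality_left i S.g N) (homology_exact₂ hS _ i)

lemma tor_exact₃ {S : ShortComplex (ModuleCat.{u} A)} (hS : S.ShortExact) (N : ModuleCat.{u} A)
    (i : ℕ) : Function.Exact (torMapLeft (i + 1) S.g N) (torδ hS N i) :=
  exact_of_iso (torIso (i + 1) S.X₂ N) (torIso (i + 1) S.X₃ N) (torIso i S.X₁ N)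
    (torIso_naturality_left (i + 1) S.g N) (by simp [torδ]) (homology_exact₃ hS _ i)

/-- `Tor₀` is the tensor product. -/
def torZeroIso (M N : ModuleCat.{u} A) : torObj 0 M N ≅ M ⊗ N :=
  ((tensoringLeft (ModuleCat.{u} A)).obj M).leftDerivedZeroIsoSelf.app N

lemma torZeroIso_naturality_right (M : ModuleCat.{u} A) {N N' : ModuleCat.{u} A} (φ : N ⟶ N') :
    torMapRight 0 M φ ≫ (torZeroIso M N').hom = (torZeroIso M N).hom ≫ M ◁ φ :=
  ((tensoringLeft (ModuleCat.{u} A)).obj M).leftDerivedZeroIsoSelf.hom.naturality φ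

/-- The augmentation of `M ⊗ P`, for the chosen projective resolution `P` of `N`. -/
def opcyclesZeroTo (M N : ModuleCat.{u} A) :
    (tensorComplex M (projectiveResolution N).complex).opcycles 0 ⟶ M ⊗ N :=
  (projectiveResolution N).fromLeftDerivedZero' ((tensoringLeft (ModuleCat.{u} A)).obj M)

lemma pOpcycles_opcyclesZeroTo (M N : ModuleCat.{u} A) :
    (tensorComplex M (projectiveResolution N).complex).pOpcycles 0 ≫ opcyclesZeroTo M N =
      M ◁ (projectiveResolution N).π.f 0 :=
  ProjectiveResolution.pOpcycles_comp_fromLeftDerivedZero' _ _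

lemma opcyclesZeroTo_naturality {M M' : ModuleCat.{u} A} (f : M ⟶ M') (N : ModuleCat.{u} A) :
    HomologicalComplex.opcyclesMap
      (tensorComplexMapLeft f (projectiveResolution N).complex) 0 ≫ opcyclesZeroTo M' N =
      opcyclesZeroTo M N ≫ f ▷ N := by
  rw [← cancel_epi (HomologicalComplex.pOpcycles _ _), HomologicalComplex.p_opcyclesMap_assoc,
    pOpcycles_opcyclesZeroTo, reassoc_of% pOpcycles_opcyclesZeroTo]
  exact (whisker_exchange f ((projectiveResolution N).π.f 0)).symm

/-- The map from `H₀(M ⊗ P)` to `M ⊗ N`, for the chosen projective resolution `P` of `N`. -/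
def homologyZeroTo (M N : ModuleCat.{u} A) :
    (tensorComplex M (projectiveResolution N).complex).homology 0 ⟶ M ⊗ N :=
  HomologicalComplex.homologyι (tensorComplex M (projectiveResolution N).complex) 0 ≫
    opcyclesZeroTo M N

lemma torZeroIso_hom_eq (M N : ModuleCat.{u} A) :
    (torZeroIso M N).hom = (torIso 0 M N).hom ≫ homologyZeroTo M N :=
  (projectiveResolution N).fromLeftDerivedZero_eq _

lemma homologyZeroTo_naturality {M M' : ModuleCat.{u} A} (f : M ⟶ M') (N : ModuleCat.{u} A) :
    HomologicalComplex.homologyMap (tensorComplexMapLeft f (projectiveResolution N).complex) 0 ≫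
      homologyZeroTo M' N = homologyZeroTo M N ≫ f ▷ N := by
  rw [homologyZeroTo, homologyZeroTo, HomologicalComplex.homologyι_naturality_assoc,
    Category.assoc, opcyclesZeroTo_naturality]

lemma torZeroIso_naturality_left {M M' : ModuleCat.{u} A} (f : M ⟶ M') (N : ModuleCat.{u} A) :
    torMapLeft 0 f N ≫ (torZeroIso M' N).hom = (torZeroIso M N).hom ≫ f ▷ N := by
  rw [torZeroIso_hom_eq, torZeroIso_hom_eq, Category.assoc, ← homologyZeroTo_naturality,
    ← Category.assoc, ← Category.assoc, torIso_naturality_left]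

lemma isZero_torObj_succ (i : ℕ) (M N : ModuleCat.{u} A) [Module.Flat A M] :
    Limits.IsZero (torObj (i + 1) M N) := by
  refine Limits.IsZero.of_iso ?_ (torIso (i + 1) M N)
  rw [← HomologicalComplex.exactAt_iff_isZero_homology]
  have h := Module.Flat.lTensor_shortComplex_exact M
    ((projectiveResolution N).complex.sc (i + 1)) ((projectiveResolution N).complex_exactAt_succ i)
  exact h

end TorLES

/-! ### The same long exact sequence for unbundled modules and linear maps -/

open TorLES

/-- `Tor_i^A(M, N)`, computed by resolving the second argument. -/
abbrev TorRight (A : Type u) [CommRing A] (i : ℕ) (M N : Type u)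
    [AddCommGroup M] [Module A M] [AddCommGroup N] [Module A N] : Type u :=
  torObj i (ModuleCat.of A M) (ModuleCat.of A N)

namespace TorRight

variable {A : Type u} [CommRing A]
  {M M' M'' L L' L'' N N' N'' : Type u}
  [AddCommGroup M] [Module A M] [AddCommGroup M'] [Module A M'] [AddCommGroup M''] [Module A M'']
  [AddCommGroup L] [Module A L] [AddCommGroup L'] [Module A L'] [AddCommGroup L''] [Module A L'']
  [AddCommGroup N] [Module A N] [AddCommGroup N'] [Module A N'] [AddCommGroup N''] [Module A N'']

/-- Functoriality of `TorRight` in the first variable. -/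
def mapLeft (i : ℕ) (f : M →ₗ[A] M') (N : Type u) [AddCommGroup N] [Module A N] :
    TorRight A i M N →ₗ[A] TorRight A i M' N :=
  (torMapLeft i (ModuleCat.ofHom f) (ModuleCat.of A N)).hom

/-- Functoriality of `TorRight` in the second variable. -/
def mapRight (i : ℕ) (M : Type u) [AddCommGroup M] [Module A M] (φ : N →ₗ[A] N') :
    TorRight A i M N →ₗ[A] TorRight A i M N' :=
  (torMapRight i (ModuleCat.of A M) (ModuleCat.ofHom φ)).hom

lemma mapLeft_mapLeft (i : ℕ) (f : M →ₗ[A] M') (g : M' →ₗ[A] M'') (x : TorRight A i M N) :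
    mapLeft i g N (mapLeft i f N x) = mapLeft i (g ∘ₗ f) N x := by
  simp [mapLeft, torMapLeft]

lemma mapRight_mapRight (i : ℕ) (φ : N →ₗ[A] N') (ψ : N' →ₗ[A] N'') (x : TorRight A i M N) :
    mapRight i M ψ (mapRight i M φ x) = mapRight i M (ψ ∘ₗ φ) x := by
  simp [mapRight, torMapRight]

lemma mapLeft_mapRight (i : ℕ) (f : M →ₗ[A] M') (φ : N →ₗ[A] N') (x : TorRight A i M N) :
    mapRight i M' φ (mapLeft i f N x) = mapLeft i f N' (mapRight i M φ x) :=
  (congrArg (fun a => a.hom x) ((NatTrans.leftDerived ((tensoringLeft (ModuleCat.{u} A)).map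
    (ModuleCat.ofHom f)) i).naturality (ModuleCat.ofHom φ))).symm

/-- `Tor₀` is the tensor product. -/
def zeroEquiv (A M N : Type u) [CommRing A] [AddCommGroup M] [Module A M] [AddCommGroup N]
    [Module A N] : TorRight A 0 M N ≃ₗ[A] M ⊗[A] N :=
  (torZeroIso (ModuleCat.of A M) (ModuleCat.of A N)).toLinearEquiv

lemma zeroEquiv_mapLeft (f : M →ₗ[A] M') (x : TorRight A 0 M N) :
    zeroEquiv A M' N (mapLeft 0 f N x) = f.rTensor N (zeroEquiv A M N x) :=
  congrArg (fun a => a.hom x) (torZeroIso_naturality_left (ModuleCat.ofHom f) (ModuleCat.of A N))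

lemma zeroEquiv_mapRight (φ : N →ₗ[A] N') (x : TorRight A 0 M N) :
    zeroEquiv A M N' (mapRight 0 M φ x) = φ.lTensor M (zeroEquiv A M N x) :=
  congrArg (fun a => a.hom x) (torZeroIso_naturality_right (ModuleCat.of A M) (ModuleCat.ofHom φ))

lemma subsingleton_succ (i : ℕ) [h : Module.Flat A M] : Subsingleton (TorRight A (i + 1) M N) :=
  have : Module.Flat A (ModuleCat.of A M) := h
  ModuleCat.subsingleton_of_isZero (isZero_torObj_succ i (ModuleCat.of A M) (ModuleCat.of A N))

lemma mapLeft_zero (i : ℕ) (x : TorRight A i M N) :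
    mapLeft i (0 : M →ₗ[A] M') N x = 0 := by
  -- Functoriality is enough: the zero map factors through the zero module, which is flat and so has
  -- no higher Tor.
  have h : (0 : M →ₗ[A] M') = (0 : PUnit.{u + 1} →ₗ[A] M') ∘ₗ (0 : M →ₗ[A] PUnit.{u + 1}) := rfl
  rw [h, ← mapLeft_mapLeft]
  cases i with
  | zero =>
    apply (zeroEquiv A M' N).injective
    rw [zeroEquiv_mapLeft, LinearMap.rTensor_zero, LinearMap.zero_apply, map_zero]
  | succ i =>
    have := subsingleton_succ (A := A) (M := PUnit.{u + 1}) (N := N) i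
    rw [Subsingleton.elim (mapLeft (i + 1) (0 : M →ₗ[A] PUnit.{u + 1}) N x) 0, map_zero]

lemma mapRight_zero (i : ℕ) (x : TorRight A i M N) :
    mapRight i M (0 : N →ₗ[A] N') x = 0 := by
  have h : (0 : N →ₗ[A] N') = (0 : PUnit.{u + 1} →ₗ[A] N') ∘ₗ (0 : N →ₗ[A] PUnit.{u + 1}) := rfl
  rw [h, ← mapRight_mapRight]
  cases i with
  | zero =>
    apply (zeroEquiv A M N').injective
    rw [zeroEquiv_mapRight, LinearMap.lTensor_zero, LinearMap.zero_apply, map_zero]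
  | succ i =>
    have : Subsingleton (TorRight A (i + 1) M PUnit.{u + 1}) := by
      have : Projective (ModuleCat.of A PUnit.{u + 1}) :=
        (IsProjective.iff_projective (R := A) (P := PUnit.{u + 1})).1 inferInstance
      exact ModuleCat.subsingleton_of_isZero
        (Functor.isZero_leftDerived_obj_projective_succ _ i (ModuleCat.of A PUnit.{u + 1}))
    rw [Subsingleton.elim (mapRight (i + 1) M (0 : N →ₗ[A] PUnit.{u + 1}) x) 0, map_zero]

/-- The short complex attached to an exact pair of linear maps. -/
abbrev shortComplex (f : M' →ₗ[A] L) (g : L →ₗ[A] M) (h : Function.Exact f g) :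
    ShortComplex (ModuleCat.{u} A) :=
  ModuleCat.shortComplexOfCompEqZero f g h.linearMap_comp_eq_zero

lemma shortComplex_shortExact {f : M' →ₗ[A] L} {g : L →ₗ[A] M} (hf : Function.Injective f)
    (h : Function.Exact f g) (hg : Function.Surjective g) : (shortComplex f g h).ShortExact :=
  ModuleCat.shortComplex_shortExact _ h hf hg

/-- The connecting map of `TorRight` in the first variable. -/
def δ {f : M' →ₗ[A] L} {g : L →ₗ[A] M} (hf : Function.Injective f) (h : Function.Exact f g)
    (hg : Function.Surjective g) (N : Type u) [AddCommGroup N] [Module A N] (i : ℕ) :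
    TorRight A (i + 1) M N →ₗ[A] TorRight A i M' N :=
  (torδ (shortComplex_shortExact hf h hg) (ModuleCat.of A N) i).hom

section

variable {f : M' →ₗ[A] L} {g : L →ₗ[A] M} (hf : Function.Injective f) (h : Function.Exact f g)
  (hg : Function.Surjective g)

lemma exact₁ (N : Type u) [AddCommGroup N] [Module A N] (i : ℕ) :
    Function.Exact (δ hf h hg N i) (mapLeft i f N) :=
  tor_exact₁ (shortComplex_shortExact hf h hg) (ModuleCat.of A N) i

lemma exact₂ (hf : Function.Injective f) (h : Function.Exact f g)
    (hg : Function.Surjective g) (N : Type u) [AddCommGroup N] [Module A N] (i : ℕ) :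
    Function.Exact (mapLeft i f N) (mapLeft i g N) :=
  tor_exact₂ (shortComplex_shortExact hf h hg) (ModuleCat.of A N) i

lemma exact₃ (N : Type u) [AddCommGroup N] [Module A N] (i : ℕ) :
    Function.Exact (mapLeft (i + 1) g N) (δ hf h hg N i) :=
  tor_exact₃ (shortComplex_shortExact hf h hg) (ModuleCat.of A N) i

lemma δ_mapRight (φ : N →ₗ[A] N') (i : ℕ) (x : TorRight A (i + 1) M N) :
    mapRight i M' φ (δ hf h hg N i x) = δ hf h hg N' i (mapRight (i + 1) M φ x) :=
  congrArg (fun a => a.hom x)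
    (torδ_naturality_right (shortComplex_shortExact hf h hg) (ModuleCat.ofHom φ) i)

lemma δ_mapLeft {f' : N' →ₗ[A] L'} {g' : L' →ₗ[A] M''} (hf' : Function.Injective f')
    (h' : Function.Exact f' g') (hg' : Function.Surjective g') (a : M' →ₗ[A] N') (b : L →ₗ[A] L')
    (c : M →ₗ[A] M'') (hab : f' ∘ₗ a = b ∘ₗ f) (hbc : g' ∘ₗ b = c ∘ₗ g) (i : ℕ)
    (x : TorRight A (i + 1) M N) :
    mapLeft i a N (δ hf h hg N i x) = δ hf' h' hg' N i (mapLeft (i + 1) c N x) :=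
  congrArg (fun a => a.hom x)
    (torδ_naturality_left (shortComplex_shortExact hf h hg) (shortComplex_shortExact hf' h' hg')
      { τ₁ := ModuleCat.ofHom a
        τ₂ := ModuleCat.ofHom b
        τ₃ := ModuleCat.ofHom c
        comm₁₂ := by
          rw [← ModuleCat.ofHom_comp, ← ModuleCat.ofHom_comp, hab]
        comm₂₃ := by
          rw [← ModuleCat.ofHom_comp, ← ModuleCat.ofHom_comp, hbc] } (ModuleCat.of A N) i)

lemma δ_injective [Module.Flat A L] (N : Type u) [AddCommGroup N] [Module A N] (i : ℕ) :
    Function.Injective (δ hf h hg N i) := by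
  have := subsingleton_succ (A := A) (M := L) (N := N) i
  rw [injective_iff_map_eq_zero]
  intro x hx
  obtain ⟨y, rfl⟩ := (exact₃ hf h hg N i x).1 hx
  rw [Subsingleton.elim y 0, map_zero]

lemma δ_surjective_succ [Module.Flat A L] (N : Type u) [AddCommGroup N] [Module A N] (i : ℕ) :
    Function.Surjective (δ hf h hg N (i + 1)) := by
  have := subsingleton_succ (A := A) (M := L) (N := N) i
  exact fun x => (exact₁ hf h hg N (i + 1) x).1 (Subsingleton.elim _ _)

end

lemma mapLeft_zero_surjective {g : L →ₗ[A] M} (hg : Function.Surjective g) :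
    Function.Surjective (mapLeft 0 g N) := by
  intro x
  obtain ⟨y, hy⟩ := LinearMap.rTensor_surjective N hg (zeroEquiv A M N x)
  refine ⟨(zeroEquiv A L N).symm y, (zeroEquiv A M N).injective ?_⟩
  rw [zeroEquiv_mapLeft, LinearEquiv.apply_symm_apply, hy]

end TorRight

end

/-! ### Balancing Tor: resolving the first or the second argument -/

noncomputable section

open MonoidalCategory TensorProduct TorLES

namespace TorLES

variable {A : Type u} [CommRing A]

/-- A map on chains that kills boundaries induces a map on homology. -/
def homologyDesc (K : ChainComplex (ModuleCat.{u} A) ℕ) (j : ℕ) {W : ModuleCat.{u} A}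
    (q : K.X j ⟶ W) (hq : K.d (j + 1) j ≫ q = 0) : K.homology j ⟶ W :=
  K.homologyι j ≫ K.descOpcycles q (j + 1) (by simp) hq

lemma homologyπ_homologyDesc (K : ChainComplex (ModuleCat.{u} A) ℕ) (j : ℕ) {W : ModuleCat.{u} A}
    (q : K.X j ⟶ W) (hq : K.d (j + 1) j ≫ q = 0) :
    K.homologyπ j ≫ homologyDesc K j q hq = K.iCycles j ≫ q := by
  simp [homologyDesc]

lemma homologyπ_surjective (K : ChainComplex (ModuleCat.{u} A) ℕ) (j : ℕ) :
    Function.Surjective (K.homologyπ j) :=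
  (ModuleCat.epi_iff_surjective _).1 inferInstance

lemma homologyDesc_apply (K : ChainComplex (ModuleCat.{u} A) ℕ) (j : ℕ) {W : ModuleCat.{u} A}
    (q : K.X j ⟶ W) (hq : K.d (j + 1) j ≫ q = 0) (c : K.cycles j) :
    homologyDesc K j q hq (K.homologyπ j c) = q (K.iCycles j c) :=
  congrArg (fun a => a.hom c) (homologyπ_homologyDesc K j q hq)

lemma homologyDesc_naturality {K K' : ChainComplex (ModuleCat.{u} A) ℕ} (ψ : K ⟶ K') (j : ℕ)
    {W W' : ModuleCat.{u} A} (q : K.X j ⟶ W) (hq : K.d (j + 1) j ≫ q = 0)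
    (q' : K'.X j ⟶ W') (hq' : K'.d (j + 1) j ≫ q' = 0) (w : W ⟶ W')
    (h : q ≫ w = ψ.f j ≫ q') :
    homologyDesc K j q hq ≫ w =
      HomologicalComplex.homologyMap ψ j ≫ homologyDesc K' j q' hq' := by
  rw [← cancel_epi (K.homologyπ j), reassoc_of% homologyπ_homologyDesc, h,
    HomologicalComplex.homologyπ_naturality_assoc, homologyπ_homologyDesc,
    HomologicalComplex.cyclesMap_i_assoc]

lemma homologyDesc_injective (K : ChainComplex (ModuleCat.{u} A) ℕ) (j : ℕ) {W : ModuleCat.{u} A}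
    (q : K.X j ⟶ W) (hq : K.d (j + 1) j ≫ q = 0) (hex : Function.Exact (K.d (j + 1) j) q) :
    Function.Injective (homologyDesc K j q hq) := by
  rw [injective_iff_map_eq_zero]
  intro x hx
  obtain ⟨c, rfl⟩ := homologyπ_surjective K j x
  rw [homologyDesc_apply] at hx
  obtain ⟨y, hy⟩ := (hex _).1 hx
  have hc : K.toCycles (j + 1) j y = c := by
    apply (ModuleCat.mono_iff_injective (K.iCycles j)).1 inferInstance
    rw [← hy]
    exact congrArg (fun a => a.hom y) (K.toCycles_i (j + 1) j)
  rw [← hc]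
  exact congrArg (fun a => a.hom y) (K.toCycles_comp_homologyπ (j + 1) j)

lemma exists_cycle_succ (K : ChainComplex (ModuleCat.{u} A) ℕ) (j : ℕ) (y : K.X (j + 1))
    (hy : K.d (j + 1) j y = 0) : ∃ c : K.cycles (j + 1), K.iCycles (j + 1) c = y := by
  -- The element `y` is encoded as a map from a free module of rank one, lifted to the right
  -- universe, so that the universal property of cycles applies.
  let a : ModuleCat.of A (ULift.{u} A) ⟶ K.X (j + 1) := ModuleCat.ofHom
    ((LinearMap.toSpanSingleton A (K.X (j + 1)) y) ∘ₗ (ULift.moduleEquiv (R := A)).toLinearMap)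
  have ha : a ≫ K.d (j + 1) j = 0 := by
    ext
    simp [a, hy]
  refine ⟨K.liftCycles a j (by simp) ha ⟨1⟩, ?_⟩
  rw [← ConcreteCategory.comp_apply, K.liftCycles_i]
  simp [a]

lemma exists_cycle_zero (K : ChainComplex (ModuleCat.{u} A) ℕ) (y : K.X 0) :
    ∃ c : K.cycles 0, K.iCycles 0 c = y :=
  (ModuleCat.epi_iff_surjective (K.iCycles 0)).1 inferInstance y

/-- The differential factors as `r ∘ q`, so the cycles are the preimage under `q` of `ker r`; as `q`
is onto, they map onto `ker r`. -/
lemma range_homologyDesc_succ (K : ChainComplex (ModuleCat.{u} A) ℕ) (j : ℕ) {W : ModuleCat.{u} A}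
    (q : K.X (j + 1) ⟶ W) (hq : K.d (j + 1 + 1) (j + 1) ≫ q = 0) (hs : Function.Surjective q)
    (r : W ⟶ K.X j) (hr : q ≫ r = K.d (j + 1) j) :
    LinearMap.range (homologyDesc K (j + 1) q hq).hom = LinearMap.ker r.hom := by
  have hr' (y) : r (q y) = K.d (j + 1) j y := congrArg (fun a => a.hom y) hr
  ext w
  constructor
  · rintro ⟨x, rfl⟩
    obtain ⟨c, rfl⟩ := homologyπ_surjective K (j + 1) x
    change r (homologyDesc K (j + 1) q hq (K.homologyπ (j + 1) c)) = 0
    rw [homologyDesc_apply, hr']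
    exact congrArg (fun a => a.hom c) (K.iCycles_d (j + 1) j)
  · intro hw
    obtain ⟨y, rfl⟩ := hs w
    obtain ⟨c, rfl⟩ := exists_cycle_succ K j y ((hr' y).symm.trans hw)
    exact ⟨K.homologyπ (j + 1) c, homologyDesc_apply K _ q hq c⟩

lemma homologyDesc_zero_surjective (K : ChainComplex (ModuleCat.{u} A) ℕ) {W : ModuleCat.{u} A}
    (q : K.X 0 ⟶ W) (hq : K.d 1 0 ≫ q = 0) (hs : Function.Surjective q) :
    Function.Surjective (homologyDesc K 0 q hq) := by
  intro w
  obtain ⟨y, rfl⟩ := hs w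
  obtain ⟨c, rfl⟩ := exists_cycle_zero K y
  exact ⟨K.homologyπ 0 c, homologyDesc_apply K _ q hq c⟩

/-- The complex `P ⊗ N`. -/
abbrev complexTensor (P : ChainComplex (ModuleCat.{u} A) ℕ) (N : ModuleCat.{u} A) :
    ChainComplex (ModuleCat.{u} A) ℕ :=
  (((tensoringRight (ModuleCat.{u} A)).obj N).mapHomologicalComplex (ComplexShape.down ℕ)).obj P

/-- The map `P ⊗ N ⟶ P ⊗ N'`. -/
abbrev complexTensorMap (P : ChainComplex (ModuleCat.{u} A) ℕ) {N N' : ModuleCat.{u} A}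
    (φ : N ⟶ N') : complexTensor P N ⟶ complexTensor P N' :=
  (NatTrans.mapHomologicalComplex ((tensoringRight (ModuleCat.{u} A)).map φ)
    (ComplexShape.down ℕ)).app P

/-- `TorModule` is computed by any projective resolution of the first argument. -/
def torModuleIso {M : ModuleCat.{u} A} (P : ProjectiveResolution M) (i : ℕ) (N : ModuleCat.{u} A) :
    TorModule A i M N ≅ (complexTensor P.complex N).homology i :=
  P.isoLeftDerivedObj ((tensoringRight (ModuleCat.{u} A)).obj N) i

lemma torModuleIso_naturality {M : ModuleCat.{u} A} (P : ProjectiveResolution M) (i : ℕ)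
    {N N' : ModuleCat.{u} A} (φ : N ⟶ N') :
    torMap A i M φ.hom ≫ (torModuleIso P i N').hom = (torModuleIso P i N).hom ≫
      HomologicalComplex.homologyMap (complexTensorMap P.complex φ) i := by
  rw [← Iso.eq_comp_inv, Category.assoc]
  exact ProjectiveResolution.leftDerived_app_eq _ P i

/-- The map from `Tor` to a module induced by a map on chains killing boundaries. -/
def torModuleDesc {M : ModuleCat.{u} A} (P : ProjectiveResolution M) (i : ℕ)
    {W : ModuleCat.{u} A} (q : P.complex.X i ⟶ W) (hq : P.complex.d (i + 1) i ≫ q = 0)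
    (N : ModuleCat.{u} A) : TorModule A i M N →ₗ[A] W ⊗[A] N :=
  ((torModuleIso P i N).hom ≫ homologyDesc (complexTensor P.complex N) i (W := W ⊗ N) (q ▷ N)
    (by
      change P.complex.d (i + 1) i ▷ N ≫ q ▷ N = 0
      rw [← comp_whiskerRight, hq, MonoidalPreadditive.zero_whiskerRight])).hom

lemma torModuleDesc_naturality {M : ModuleCat.{u} A} (P : ProjectiveResolution M) (i : ℕ)
    {W : ModuleCat.{u} A} (q : P.complex.X i ⟶ W) (hq : P.complex.d (i + 1) i ≫ q = 0)
    {N N' : ModuleCat.{u} A} (φ : N ⟶ N') (x : TorModule A i M N) :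
    φ.hom.lTensor W (torModuleDesc P i q hq N x) =
      torModuleDesc P i q hq N' (torMap A i M φ.hom x) := by
  have h := congrArg (fun a => (torModuleIso P i N).hom ≫ a)
    (homologyDesc_naturality (complexTensorMap P.complex φ) i (W := W ⊗ N) (W' := W ⊗ N')
      (q ▷ N) (by
      change P.complex.d (i + 1) i ▷ N ≫ q ▷ N = 0
      rw [← comp_whiskerRight, hq, MonoidalPreadditive.zero_whiskerRight]) (q ▷ N') (by
      change P.complex.d (i + 1) i ▷ N' ≫ q ▷ N' = 0
      rw [← comp_whiskerRight, hq, MonoidalPreadditive.zero_whiskerRight]) (W ◁ φ)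
      (whisker_exchange q φ).symm)
  rw [← reassoc_of% torModuleIso_naturality P i φ] at h
  exact congrArg (fun a => a.hom x) h

lemma torModuleDesc_injective {M : ModuleCat.{u} A} (P : ProjectiveResolution M) (i : ℕ)
    {W : ModuleCat.{u} A} (q : P.complex.X i ⟶ W) (hq : P.complex.d (i + 1) i ≫ q = 0)
    (hex : Function.Exact (P.complex.d (i + 1) i) q) (hs : Function.Surjective q)
    (N : ModuleCat.{u} A) : Function.Injective (torModuleDesc P i q hq N) := by
  refine (homologyDesc_injective _ i _ _ ?_).comp (torModuleIso P i N).toLinearEquiv.injective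
  exact rTensor_exact (f := (P.complex.d (i + 1) i).hom) (g := q.hom) N hex hs

lemma torModuleDesc_zero_surjective {M : ModuleCat.{u} A} (P : ProjectiveResolution M)
    {W : ModuleCat.{u} A} (q : P.complex.X 0 ⟶ W) (hq : P.complex.d 1 0 ≫ q = 0)
    (hs : Function.Surjective q) (N : ModuleCat.{u} A) :
    Function.Surjective (torModuleDesc P 0 q hq N) :=
  (homologyDesc_zero_surjective (complexTensor P.complex N) (W := W ⊗ N) (q ▷ N) _
    (LinearMap.rTensor_surjective N (g := q.hom) hs)).comp
      (torModuleIso P 0 N).toLinearEquiv.surjective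

lemma range_torModuleDesc_succ {M : ModuleCat.{u} A} (P : ProjectiveResolution M) (i : ℕ)
    {W : ModuleCat.{u} A} (q : P.complex.X (i + 1) ⟶ W)
    (hq : P.complex.d (i + 1 + 1) (i + 1) ≫ q = 0) (hs : Function.Surjective q)
    (r : W ⟶ P.complex.X i) (hr : q ≫ r = P.complex.d (i + 1) i) (N : ModuleCat.{u} A) :
    LinearMap.range (torModuleDesc P (i + 1) q hq N) = LinearMap.ker (r.hom.rTensor N) := by
  have h := range_homologyDesc_succ (complexTensor P.complex N) i (W := W ⊗ N) (q ▷ N) (by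
      change P.complex.d (i + 1 + 1) (i + 1) ▷ N ≫ q ▷ N = 0
      rw [← comp_whiskerRight, hq, MonoidalPreadditive.zero_whiskerRight])
    (LinearMap.rTensor_surjective N (g := q.hom) hs) (r ▷ N) (by
      change q ▷ N ≫ r ▷ N = P.complex.d (i + 1) i ▷ N
      rw [← comp_whiskerRight, hr])
  rw [torModuleDesc, ModuleCat.hom_comp]
  exact (LinearMap.range_comp_of_range_eq_top _
    (LinearMap.range_eq_top.2 (torModuleIso P (i + 1) N).toLinearEquiv.surjective)).trans h

open TorRight

lemma projectiveResolution_flat {M : ModuleCat.{u} A} (P : ProjectiveResolution M) (j : ℕ) :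
    Module.Flat A (P.complex.X j) :=
  have := P.projective j
  flat_of_projective _

/-- The module of boundaries in degree `j` of a projective resolution. -/
abbrev boundaries {M : ModuleCat.{u} A} (P : ProjectiveResolution M) (j : ℕ) :
    Submodule A (P.complex.X j) :=
  LinearMap.range (P.complex.d (j + 1) j).hom

lemma exact_augmentation {M : ModuleCat.{u} A} (P : ProjectiveResolution M) :
    Function.Exact (P.complex.d 1 0) (P.π.f 0) :=
  function_exact_of_exact P.exact₀

lemma exact_differential {M : ModuleCat.{u} A} (P : ProjectiveResolution M) (j : ℕ) :
    Function.Exact (P.complex.d (j + 1 + 1) (j + 1)) (P.complex.d (j + 1) j) :=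
  function_exact_of_exact (P.exact_succ j)

lemma augmentation_surjective {M : ModuleCat.{u} A} (P : ProjectiveResolution M) :
    Function.Surjective (P.π.f 0) :=
  (ModuleCat.epi_iff_surjective _).1 inferInstance

lemma exact_subtype_augmentation {M : ModuleCat.{u} A} (P : ProjectiveResolution M) :
    Function.Exact (boundaries P 0).subtype (P.π.f 0).hom := by
  rw [LinearMap.exact_iff, Submodule.range_subtype]
  exact (LinearMap.exact_iff.1 (exact_augmentation P))

lemma exact_subtype_rangeRestrict {M : ModuleCat.{u} A} (P : ProjectiveResolution M) (j : ℕ) :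
    Function.Exact (boundaries P (j + 1)).subtype (P.complex.d (j + 1) j).hom.rangeRestrict := by
  rw [LinearMap.exact_iff, Submodule.range_subtype, LinearMap.ker_rangeRestrict]
  exact (LinearMap.exact_iff.1 (exact_differential P j))

/-- Dimension shifting along a projective resolution of the first argument. -/
lemma exists_shift {M : ModuleCat.{u} A} (P : ProjectiveResolution M) (j : ℕ) :
    ∀ k n : ℕ, n = j + k + 1 →
      ∃ γ : ∀ N : ModuleCat.{u} A, TorRight A n M N →ₗ[A] TorRight A k (boundaries P j) N,
        (∀ N, Function.Injective (γ N)) ∧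
        (∀ N, Function.Exact (γ N) (mapLeft k (boundaries P j).subtype N)) ∧
        ∀ (N N' : ModuleCat.{u} A) (φ : N →ₗ[A] N') (x : TorRight A n M N),
          mapRight k (boundaries P j) φ (γ N x) = γ N' (mapRight n M φ x) := by
  induction j with
  | zero =>
    intro k n hn
    obtain rfl : n = k + 1 := by omega
    have := projectiveResolution_flat P 0
    let hi := (boundaries P 0).injective_subtype
    let he := exact_subtype_augmentation P
    let hs := augmentation_surjective P
    exact ⟨fun N => δ hi he hs N k, fun N => δ_injective hi he hs N k,
      fun N => exact₁ hi he hs N k, fun N N' φ x => δ_mapRight hi he hs φ k x⟩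
  | succ j ih =>
    intro k n hn
    obtain ⟨γ, h₁, h₂, h₃⟩ := ih (k + 1) n (by omega)
    have := projectiveResolution_flat P j
    have := projectiveResolution_flat P (j + 1)
    let hi := (boundaries P (j + 1)).injective_subtype
    let he := exact_subtype_rangeRestrict P j
    let hs := (P.complex.d (j + 1) j).hom.surjective_rangeRestrict
    have hγ (N : ModuleCat.{u} A) : Function.Surjective (γ N) := fun x =>
      have := TorRight.subsingleton_succ (A := A) (M := P.complex.X j) (N := N) k
      (h₂ N x).1 (Subsingleton.elim _ _)
    refine ⟨fun N => δ hi he hs N k ∘ₗ γ N, fun N => (δ_injective hi he hs N k).comp (h₁ N),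
      fun N => ?_, fun N N' φ x => ?_⟩
    · rw [LinearMap.exact_iff, LinearMap.range_comp_of_range_eq_top _
        (LinearMap.range_eq_top.2 (hγ N))]
      exact LinearMap.exact_iff.1 (exact₁ hi he hs N k)
    · rw [LinearMap.comp_apply, LinearMap.comp_apply, δ_mapRight, h₃]

/-- Two linear maps which are injective with the same range have isomorphic sources. -/
def equivOfRangeEq {X Y Z : Type*} [AddCommGroup X] [Module A X] [AddCommGroup Y] [Module A Y]
    [AddCommGroup Z] [Module A Z] (α : X →ₗ[A] Z) (β : Y →ₗ[A] Z) (hα : Function.Injective α)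
    (hβ : Function.Injective β) (h : LinearMap.range α = LinearMap.range β) : X ≃ₗ[A] Y :=
  (LinearEquiv.ofInjective α hα).trans
    ((LinearEquiv.ofEq _ _ h).trans (LinearEquiv.ofInjective β hβ).symm)

lemma apply_equivOfRangeEq {X Y Z : Type*} [AddCommGroup X] [Module A X] [AddCommGroup Y]
    [Module A Y] [AddCommGroup Z] [Module A Z] (α : X →ₗ[A] Z) (β : Y →ₗ[A] Z)
    (hα : Function.Injective α) (hβ : Function.Injective β)
    (h : LinearMap.range α = LinearMap.range β) (x : X) :
    β (equivOfRangeEq α β hα hβ h x) = α x :=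
  congrArg Subtype.val ((LinearEquiv.ofInjective β hβ).apply_symm_apply
    (LinearEquiv.ofEq _ _ h (LinearEquiv.ofInjective α hα x)))

/-- `Tor` computed by resolving the first argument agrees with `Tor` computed by resolving the
second argument, naturally in the second argument. -/
theorem exists_torModule_equiv (M : ModuleCat.{u} A) (i : ℕ) :
    ∃ e : ∀ N : ModuleCat.{u} A, TorModule A i M N ≃ₗ[A] TorRight A i M N,
      ∀ (N N' : ModuleCat.{u} A) (φ : N →ₗ[A] N') (x : TorModule A i M N),
        e N' (torMap A i M φ x) = mapRight i M φ (e N x) := by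
  let P := projectiveResolution M
  -- Both versions of Tor embed naturally in one module `W ⊗ N` with the same image. In degree zero
  -- `W = M`; in degree `i + 1`, `W` is the module of boundaries in `P_i` and the common image is
  -- the kernel of `W ⊗ N → P_i ⊗ N`.
  suffices ∃ (W : ModuleCat.{u} A) (α : ∀ N : ModuleCat.{u} A, TorModule A i M N →ₗ[A] W ⊗[A] N)
      (β : ∀ N : ModuleCat.{u} A, TorRight A i M N →ₗ[A] W ⊗[A] N),
      (∀ N, Function.Injective (α N)) ∧ (∀ N, Function.Injective (β N)) ∧
      (∀ N, LinearMap.range (α N) = LinearMap.range (β N)) ∧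
      (∀ (N N' : ModuleCat.{u} A) (φ : N →ₗ[A] N') (x : TorModule A i M N),
        φ.lTensor W (α N x) = α N' (torMap A i M φ x)) ∧
      ∀ (N N' : ModuleCat.{u} A) (φ : N →ₗ[A] N') (x : TorRight A i M N),
        φ.lTensor W (β N x) = β N' (mapRight i M φ x) by
    obtain ⟨W, α, β, hα, hβ, h, nα, nβ⟩ := this
    refine ⟨fun N => equivOfRangeEq (α N) (β N) (hα N) (hβ N) (h N), fun N N' φ x => ?_⟩
    apply hβ N'
    rw [apply_equivOfRangeEq, ← nα, ← nβ, apply_equivOfRangeEq]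
  cases i with
  | zero =>
    refine ⟨M, torModuleDesc P 0 (P.π.f 0) P.complex_d_comp_π_f_zero,
      fun N => (zeroEquiv A M N).toLinearMap,
      torModuleDesc_injective P 0 _ _ (exact_augmentation P) (augmentation_surjective P),
      fun N => (zeroEquiv A M N).injective, fun N => ?_,
      fun N N' φ x => torModuleDesc_naturality P 0 _ _ (ModuleCat.ofHom φ) x,
      fun N N' φ x => (zeroEquiv_mapRight φ x).symm⟩
    rw [LinearEquiv.range, LinearMap.range_eq_top]
    exact torModuleDesc_zero_surjective P _ _ (augmentation_surjective P) N
  | succ i =>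
    obtain ⟨γ, h₁, h₂, h₃⟩ := exists_shift P i 0 (i + 1) rfl
    let q : P.complex.X (i + 1) ⟶ ModuleCat.of A (boundaries P i) :=
      ModuleCat.ofHom (P.complex.d (i + 1) i).hom.rangeRestrict
    let r : ModuleCat.of A (boundaries P i) ⟶ P.complex.X i :=
      ModuleCat.ofHom (boundaries P i).subtype
    have hex : Function.Exact (P.complex.d (i + 1 + 1) (i + 1)) q := by
      have := exact_differential P i
      exact fun y => ⟨fun hy => (this y).1 (congrArg Subtype.val hy),
        fun hy => Subtype.ext ((this y).2 hy)⟩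
    have hs : Function.Surjective q := (P.complex.d (i + 1) i).hom.surjective_rangeRestrict
    have hq : P.complex.d (i + 1 + 1) (i + 1) ≫ q = 0 := by
      exact ModuleCat.hom_ext (LinearMap.ext fun x => hex.apply_apply_eq_zero x)
    refine ⟨ModuleCat.of A (boundaries P i), torModuleDesc P (i + 1) q hq,
      fun N => (zeroEquiv A (boundaries P i) N).toLinearMap ∘ₗ γ N,
      torModuleDesc_injective P (i + 1) q hq hex hs,
      fun N => (zeroEquiv A _ N).injective.comp (h₁ N), fun N => ?_,
      fun N N' φ x => torModuleDesc_naturality P (i + 1) q hq (ModuleCat.ofHom φ) x,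
      fun N N' φ x => ?_⟩
    · rw [range_torModuleDesc_succ P i q hq hs r rfl]
      ext w
      obtain ⟨w, rfl⟩ := (zeroEquiv A (boundaries P i) N).surjective w
      have : (boundaries P i).subtype.rTensor N (zeroEquiv A (boundaries P i) N w) = 0 ↔
          mapLeft 0 (boundaries P i).subtype N w = 0 := by
        rw [← zeroEquiv_mapLeft, LinearEquiv.map_eq_zero_iff]
      refine this.trans ((h₂ N w).trans ⟨?_, ?_⟩)
      · rintro ⟨x, rfl⟩
        exact ⟨x, rfl⟩
      · rintro ⟨x, hx⟩
        exact ⟨x, (zeroEquiv A (boundaries P i) N).injective hx⟩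
    · rw [LinearMap.comp_apply, LinearMap.comp_apply, LinearEquiv.coe_coe, LinearEquiv.coe_coe,
        ← h₃, zeroEquiv_mapRight]

end TorLES

end

/-! ### Nilpotence in the Koszul complex -/

noncomputable section

namespace KoszulNilpotence

open ExteriorAlgebra

variable {Q : Type u} [CommRing Q] {V : Type*} [AddCommGroup V] [Module Q V]

/-- The Koszul differential on the exterior algebra given by a linear form. -/
abbrev differential (d : Module.Dual Q V) : ExteriorAlgebra Q V →ₗ[Q] ExteriorAlgebra Q V :=
  CliffordAlgebra.contractLeft (Q := (0 : QuadraticForm Q V)) d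

lemma differential_ι (d : Module.Dual Q V) (v : V) :
    differential d (ι Q v) = algebraMap Q _ (d v) :=
  CliffordAlgebra.contractLeft_ι (0 : QuadraticForm Q V) d v

lemma differential_ι_mul (d : Module.Dual Q V) (v : V) (y : ExteriorAlgebra Q V) :
    differential d (ι Q v * y) = d v • y - ι Q v * differential d y :=
  CliffordAlgebra.contractLeft_ι_mul (Q := (0 : QuadraticForm Q V)) d v y

lemma differential_one (d : Module.Dual Q V) : differential d 1 = 0 :=
  CliffordAlgebra.contractLeft_one (0 : QuadraticForm Q V) d

lemma differential_differential (d : Module.Dual Q V) (y : ExteriorAlgebra Q V) :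
    differential d (differential d y) = 0 :=
  CliffordAlgebra.contractLeft_contractLeft (Q := (0 : QuadraticForm Q V)) d y

/-- The submodule spanned by the products of two vectors. -/
def degreeTwo (Q V : Type*) [CommRing Q] [AddCommGroup V] [Module Q V] :
    Submodule Q (ExteriorAlgebra Q V) :=
  Submodule.span Q (Set.range fun p : V × V => ι Q p.1 * ι Q p.2)

lemma ι_mul_ι_mem_degreeTwo (v w : V) : ι Q v * ι Q w ∈ degreeTwo Q V :=
  Submodule.subset_span ⟨(v, w), rfl⟩

lemma ι_mul_ι_comm (v w : V) : ι Q v * ι Q w = -(ι Q w * ι Q v) :=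
  eq_neg_of_add_eq_zero_left (ι_add_mul_swap v w)

lemma commute_ι_of_mem_degreeTwo {u : ExteriorAlgebra Q V} (hu : u ∈ degreeTwo Q V) (v : V) :
    Commute u (ι Q v) := by
  induction hu using Submodule.span_induction with
  | mem x hx =>
    obtain ⟨⟨a, b⟩, rfl⟩ := hx
    change ι Q a * ι Q b * ι Q v = ι Q v * (ι Q a * ι Q b)
    rw [mul_assoc, ι_mul_ι_comm b v, mul_neg, ← mul_assoc, ι_mul_ι_comm a v, neg_mul, neg_neg,
      mul_assoc]
  | zero => exact Commute.zero_left _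
  | add x y _ _ hx hy => exact hx.add_left hy
  | smul q x _ hx => exact hx.smul_left q

/-- Passing a vector across a product of two vectors changes the sign twice. Centrality is what
makes `u` nilpotent, as a sum of commuting square-zero elements, and gives its powers the usual
derivative. -/
lemma commute_of_mem_degreeTwo {u : ExteriorAlgebra Q V} (hu : u ∈ degreeTwo Q V)
    (y : ExteriorAlgebra Q V) : Commute u y := by
  induction y using ExteriorAlgebra.induction with
  | algebraMap r => exact Algebra.commutes' r u |>.symm
  | ι v => exact commute_ι_of_mem_degreeTwo hu v
  | mul a b ha hb => exact ha.mul_right hb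
  | add a b ha hb => exact ha.add_right hb

lemma isNilpotent_of_mem_degreeTwo {u : ExteriorAlgebra Q V} (hu : u ∈ degreeTwo Q V) :
    IsNilpotent u := by
  induction hu using Submodule.span_induction with
  | mem x hx =>
    obtain ⟨⟨a, b⟩, rfl⟩ := hx
    refine ⟨2, ?_⟩
    change (ι Q a * ι Q b) ^ 2 = 0
    rw [pow_two, mul_assoc, ← mul_assoc (ι Q b), ι_mul_ι_comm b a, neg_mul, mul_neg, ← mul_assoc,
      ← mul_assoc, ι_sq_zero, zero_mul, zero_mul, neg_zero]
  | zero => exact IsNilpotent.zero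
  | add x y hx _ ihx ihy => exact (commute_of_mem_degreeTwo hx y).isNilpotent_add ihx ihy
  | smul q x _ ihx => exact ihx.smul q

lemma differential_mul_of_mem_degreeTwo (d : Module.Dual Q V) {u : ExteriorAlgebra Q V}
    (hu : u ∈ degreeTwo Q V) (y : ExteriorAlgebra Q V) :
    differential d (u * y) = differential d u * y + u * differential d y := by
  induction hu using Submodule.span_induction with
  | mem x hx =>
    obtain ⟨⟨a, b⟩, rfl⟩ := hx
    change differential d (ι Q a * ι Q b * y) =
      differential d (ι Q a * ι Q b) * y + ι Q a * ι Q b * differential d y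
    rw [mul_assoc, differential_ι_mul, differential_ι_mul, differential_ι_mul, differential_ι,
      sub_mul, mul_sub, mul_assoc, mul_assoc, smul_mul_assoc, Algebra.smul_def (d b), sub_sub_eq_add_sub]
    abel
  | zero => simp
  | add x y _ _ ihx ihy => rw [add_mul, map_add, ihx, ihy, map_add]; noncomm_ring
  | smul q x _ ihx =>
    rw [smul_mul_assoc, map_smul, ihx, map_smul, smul_add, smul_mul_assoc, smul_mul_assoc]

variable (d : Module.Dual Q V) {f g : Q} {u : ExteriorAlgebra Q V} {v : V}

lemma differential_pow (hu : u ∈ degreeTwo Q V) (hdu : differential d u = -(f • ι Q v)) (j : ℕ) :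
    differential d (u ^ (j + 1)) = -(f • ((j + 1 : ℕ) • (ι Q v * u ^ j))) := by
  induction j with
  | zero => simp [hdu]
  | succ j ih =>
    rw [pow_succ', differential_mul_of_mem_degreeTwo d hu, ih, hdu, mul_neg, mul_smul_comm,
      mul_smul_comm, ← mul_assoc, (commute_of_mem_degreeTwo hu (ι Q v)).eq, mul_assoc,
      ← pow_succ', neg_mul, smul_mul_assoc, ← neg_add, ← smul_add, succ_nsmul' _ (j + 1)]

/-- The second Leibniz term contains `v · v = 0`, since the differential of a power of `u` is a
multiple of `v`. -/
lemma differential_ι_mul_pow (hu : u ∈ degreeTwo Q V) (hdu : differential d u = -(f • ι Q v))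
    (hdv : d v = -g) (j : ℕ) :
    differential d (ι Q v * u ^ j) = -(g • u ^ j) := by
  rw [differential_ι_mul, hdv, neg_smul, sub_eq_self]
  cases j with
  | zero => rw [pow_zero, differential_one, mul_zero]
  | succ j =>
    rw [differential_pow d hu hdu, mul_neg, mul_smul_comm, mul_smul_comm, ← mul_assoc, ι_sq_zero]
    simp

/-- Elements killed by `f` in a free module are multiples of `g`, if `ann f = (g)`. -/
lemma exists_smul_eq_of_smul_eq_zero {W : Type*} [AddCommGroup W] [Module Q W] [Module.Free Q W]
    (h : ∀ q : Q, f * q = 0 → ∃ r, q = g * r) (w : W) (hw : f • w = 0) : ∃ w', w = g • w' := by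
  let b := Module.Free.chooseBasis Q W
  have h' (i) : ∃ r, b.repr w i = g * r := by
    apply h
    have := congrArg (fun x => b.repr x i) hw
    simpa using this
  choose r hr using h'
  refine ⟨∑ i ∈ (b.repr w).support, r i • b i, ?_⟩
  conv_lhs => rw [← b.linearCombination_repr w, Finsupp.linearCombination_apply, Finsupp.sum]
  rw [Finset.smul_sum]
  exact Finset.sum_congr rfl fun i _ => by rw [hr i, mul_smul]

/-- A boundary has scalar part in the ideal of values of `d`; this is what finally contradicts `1 =
∂a + f b`. -/
lemma algebraMapInv_differential_mem {I : Ideal Q} (hd : ∀ v, d v ∈ I) (y : ExteriorAlgebra Q V) :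
    algebraMapInv (differential d y) ∈ I := by
  induction y using CliffordAlgebra.left_induction with
  | algebraMap r =>
    have : differential d (algebraMap Q (ExteriorAlgebra Q V) r) = 0 := by
      rw [Algebra.algebraMap_eq_smul_one, map_smul, differential_one, smul_zero]
    exact (congrArg algebraMapInv this).trans (map_zero _) ▸ I.zero_mem
  | add x y hx hy =>
    rw [map_add, map_add]
    exact I.add_mem hx hy
  | ι_mul x v hx =>
    have h := congrArg algebraMapInv (differential_ι_mul d v x)
    rw [map_sub, map_mul algebraMapInv, map_smul] at h
    have h0 : algebraMapInv (ι Q v) = (0 : Q) := by simp [algebraMapInv]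
    rw [h0, zero_mul, sub_zero, smul_eq_mul] at h
    exact h ▸ I.mul_mem_right _ (hd v)

/-- The key nilpotence argument: if `(f, g)` is an exact pair in a ring containing `ℚ`, then in a
Koszul complex one cannot have `∂ v = -g` and `∂ u = -f v` with `v` of degree one and `u` of degree
two, as the powers of `u` would yield arbitrarily long nonzero classes. -/
theorem not_differential_eq [Module.Free Q (ExteriorAlgebra Q V)]
    (hfg : ∀ q : Q, f * q = 0 → ∃ r, q = g * r) (hgf : ∀ q : Q, g * q = 0 → ∃ r, q = f * r)
    (hQ : ∀ j : ℕ, IsUnit ((j + 1 : ℕ) : Q)) {I : Ideal Q} (hI : I ≠ ⊤) (hf : f ∈ I)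
    (hd : ∀ v, d v ∈ I) (hu : u ∈ degreeTwo Q V) (hdu : differential d u = -(f • ι Q v))
    (hdv : d v = -g) : False := by
  -- Applying `∂` to `u ^ (j + 1) = ∂a + f b` gives `f (∂b + (j + 1) v u ^ j) = 0`, so the bracket
  -- is `g b₁`. Applying `∂` again gives `g (∂b₁ + (j + 1) u ^ j) = 0`, so this bracket is `f b₂`.
  -- Dividing by `j + 1` expresses `u ^ j`.
  have step (j : ℕ) (h : ∃ a b, u ^ (j + 1) = differential d a + f • b) :
      ∃ a b, u ^ j = differential d a + f • b := by
    obtain ⟨a, b, hab⟩ := h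
    have h1 := differential_pow d hu hdu j
    rw [hab, map_add, differential_differential, zero_add, map_smul] at h1
    obtain ⟨b₁, hb₁⟩ := exists_smul_eq_of_smul_eq_zero hfg
      (differential d b + (j + 1 : ℕ) • (ι Q v * u ^ j)) (by rw [smul_add, h1]; abel)
    have h2 := congrArg (differential d) hb₁
    rw [map_add, differential_differential, zero_add, map_nsmul,
      differential_ι_mul_pow d hu hdu hdv, map_smul] at h2
    obtain ⟨b₂, hb₂⟩ := exists_smul_eq_of_smul_eq_zero hgf
      (differential d b₁ + (j + 1 : ℕ) • u ^ j) (by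
        rw [smul_add, ← h2, smul_comm g (j + 1 : ℕ), smul_neg]; abel)
    obtain ⟨c, hc⟩ := hQ j
    refine ⟨-((↑c⁻¹ : Q) • b₁), (↑c⁻¹ : Q) • b₂, ?_⟩
    have h3 : u ^ j = (↑c⁻¹ : Q) • ((j + 1 : ℕ) • u ^ j) := by
      rw [← Nat.cast_smul_eq_nsmul Q, smul_smul, ← hc, Units.inv_mul, one_smul]
    rw [h3, map_neg, map_smul, smul_comm f, ← hb₂, smul_add]
    abel
  obtain ⟨n, hn⟩ := isNilpotent_of_mem_degreeTwo hu
  -- The descent starts at `u ^ n = 0` and ends at `u ^ 0 = 1`.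
  have main (k : ℕ) (hk : k ≤ n) : ∃ a b, u ^ (n - k) = differential d a + f • b := by
    induction k with
    | zero => exact ⟨0, 0, by simp [hn]⟩
    | succ k ih =>
      have h := ih (by omega)
      rw [show n - k = n - (k + 1) + 1 by omega] at h
      exact step _ h
  obtain ⟨a, b, hab⟩ := main n le_rfl
  rw [Nat.sub_self, pow_zero] at hab
  have h := congrArg algebraMapInv hab
  rw [map_one, map_add, map_smul, smul_eq_mul] at h
  exact hI ((Ideal.eq_top_iff_one I).2 (h ▸ I.add_mem (algebraMapInv_differential_mem d hd a)
    (I.mul_mem_right _ hf)))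

/-- The linear form `(q, b) ↦ q f + d b` whose kernel is a module of syzygies. -/
abbrev extendForm (f : Q) (d : Module.Dual Q V) : Q × V →ₗ[Q] Q :=
  (LinearMap.toSpanSingleton Q Q f).coprod d

/-- Decomposable elements of the module of syzygies are Koszul boundaries. -/
lemma exists_of_mem_smul_ker {I : Ideal Q} (hI : ∀ r ∈ I, ∃ q x, r = q * f + d x)
    {z : LinearMap.ker (extendForm f d)}
    (hz : z ∈ I • (⊤ : Submodule Q (LinearMap.ker (extendForm f d)))) :
    ∃ v, ∃ u ∈ degreeTwo Q V, z.1.1 = -d v ∧ ι Q z.1.2 = differential d u + f • ι Q v := by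
  induction hz using Submodule.smul_induction_on' with
  | smul r hr z _ =>
    obtain ⟨q, x, rfl⟩ := hI r hr
    obtain ⟨⟨z₀, b⟩, hz⟩ := z
    have hz' : d b = -(z₀ * f) := by
      rw [LinearMap.mem_ker, LinearMap.coprod_apply, LinearMap.toSpanSingleton_apply,
        smul_eq_mul] at hz
      exact eq_neg_of_add_eq_zero_right hz
    -- With `r = q f + d x` and `d b = -z₀ f`, one has `∂(x b) = (d x) b + z₀ f x`; adding `f (q b -
    -- z₀ x)` leaves `r b`, and `-d (q b - z₀ x) = r z₀`.
    refine ⟨q • b - z₀ • x, ι Q x * ι Q b, ι_mul_ι_mem_degreeTwo x b, ?_, ?_⟩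
    · simp [hz']
      ring
    · rw [differential_ι_mul, differential_ι, hz', map_neg, mul_neg, sub_neg_eq_add,
        Algebra.algebraMap_eq_smul_one, mul_smul_comm, mul_one]
      change ι Q ((q * f + d x) • b) = _
      simp only [map_smul, map_sub, map_add, add_smul, smul_sub, mul_smul, smul_comm f]
      abel
  | add x _ y _ hx hy =>
    obtain ⟨v, u, hu, h1, h2⟩ := hx
    obtain ⟨v', u', hu', h1', h2'⟩ := hy
    refine ⟨v + v', u + u', add_mem hu hu', ?_, ?_⟩
    · change x.1.1 + y.1.1 = _
      rw [h1, h1', map_add]; ring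
    · change ι Q (x.1.2 + y.1.2) = _
      rw [map_add, h2, h2', map_add, map_add, smul_add]; abel

/-- Membership would produce `v` and `u` with `g = -d v` and `0 = ∂u + f v`, the configuration
excluded by `not_differential_eq`. -/
theorem syzygy_notMem_smul [Module.Free Q (ExteriorAlgebra Q V)]
    (hfg : ∀ q : Q, f * q = 0 → ∃ r, q = g * r) (hgf : ∀ q : Q, g * q = 0 → ∃ r, q = f * r)
    (hQ : ∀ j : ℕ, IsUnit ((j + 1 : ℕ) : Q)) {I : Ideal Q} (hI : I ≠ ⊤) (hf : f ∈ I)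
    (hd : ∀ v, d v ∈ I) (hI' : ∀ r ∈ I, ∃ q x, r = q * f + d x)
    {z : LinearMap.ker (extendForm f d)} (h1 : z.1.1 = g) (h2 : z.1.2 = 0) :
    z ∉ I • (⊤ : Submodule Q (LinearMap.ker (extendForm f d))) := by
  intro hz
  obtain ⟨v, u, hu, h3, h4⟩ := exists_of_mem_smul_ker d hI' hz
  rw [h2, map_zero] at h4
  rw [h1] at h3
  exact not_differential_eq d hfg hgf hQ hI hf hd hu (eq_neg_of_add_eq_zero_left h4.symm)
    (by rw [h3, neg_neg])

end KoszulNilpotence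

end

/-! ### Tor of free `Q/(f)`-modules for an exact pair -/

noncomputable section

open TensorProduct TorRight

namespace ExactPair

variable {Q : Type u} [CommRing Q]

/-- The annihilator of `f` is generated by `g`. -/
def AnnEq (f g : Q) : Prop := ∀ q : Q, f * q = 0 ↔ g ∣ q

lemma AnnEq.mul_eq_zero {f g : Q} (h : AnnEq f g) : f * g = 0 := (h g).2 dvd_rfl

lemma annEq_of_annihilator {f g : Q}
    (h : (Ideal.span {f}).annihilator = Ideal.span {g}) : AnnEq f g := by
  intro q
  rw [← Ideal.mem_span_singleton, ← h, Ideal.span, Submodule.mem_annihilator_span_singleton,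
    smul_eq_mul, mul_comm]

variable (f g : Q) (h : AnnEq f g) (h' : AnnEq g f) (n : ℕ)

/-- The projection from a free `Q`-module to the corresponding free `Q/(f)`-module. -/
abbrev proj : (Fin n → Q) →ₗ[Q] (Fin n → Q ⧸ Ideal.span {f}) :=
  (Submodule.mkQ (Ideal.span {f})).compLeft (Fin n)

/-- The map `Q/(g) → Q` given by multiplication by `f`. -/
def mulQuot (hfg : f * g = 0) : (Q ⧸ Ideal.span {g}) →ₗ[Q] Q :=
  Submodule.liftQ (Ideal.span {g}) (LinearMap.toSpanSingleton Q Q f) (by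
    rw [Ideal.span, Submodule.span_singleton_le_iff_mem, LinearMap.mem_ker,
      LinearMap.toSpanSingleton_apply, smul_eq_mul, mul_comm, hfg])

/-- The map `(Q/(g))ⁿ → Qⁿ` given by multiplication by `f`. -/
abbrev incl (hfg : f * g = 0) : (Fin n → Q ⧸ Ideal.span {g}) →ₗ[Q] (Fin n → Q) :=
  (mulQuot f g hfg).compLeft (Fin n)

variable {f g n}

lemma proj_surjective : Function.Surjective (proj f n) := by
  intro r
  choose q hq using fun l => Submodule.mkQ_surjective (Ideal.span {f}) (r l)
  exact ⟨q, funext hq⟩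

lemma incl_proj (hfg : f * g = 0) (q : Fin n → Q) : incl f g n hfg (proj g n q) = f • q := by
  ext l
  exact mul_comm _ _

lemma proj_eq_zero_iff (q : Fin n → Q) : proj f n q = 0 ↔ ∃ q', q = f • q' := by
  constructor
  · intro hq
    have (l : Fin n) : ∃ r, q l = f * r :=
      Ideal.mem_span_singleton.1 ((Submodule.Quotient.mk_eq_zero _).1 (congrFun hq l))
    choose r hr using this
    exact ⟨r, funext hr⟩
  · rintro ⟨q', rfl⟩
    ext l
    exact (Submodule.Quotient.mk_eq_zero _).2 (Ideal.mem_span_singleton.2 ⟨q' l, rfl⟩)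

lemma incl_injective (h : AnnEq f g) : Function.Injective (incl f g n h.mul_eq_zero) := by
  rw [injective_iff_map_eq_zero]
  intro r hr
  obtain ⟨q, rfl⟩ := proj_surjective r
  rw [incl_proj] at hr
  have (l : Fin n) : ∃ r, q l = g * r := (h _).1 (congrFun hr l)
  choose r hr using this
  exact (proj_eq_zero_iff q).2 ⟨r, funext hr⟩

lemma exact_incl_proj (hfg : f * g = 0) : Function.Exact (incl f g n hfg) (proj f n) := by
  intro q
  rw [proj_eq_zero_iff]
  constructor
  · rintro ⟨q', rfl⟩
    exact ⟨proj g n q', incl_proj hfg q'⟩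
  · rintro ⟨r, rfl⟩
    obtain ⟨q', rfl⟩ := proj_surjective r
    exact ⟨q', incl_proj hfg q'⟩

/-- Tensoring with a module killed by `I` inverts surjections with kernel contained in `I M`. -/
lemma rTensor_bijective {M M' X : Type*} [AddCommGroup M] [Module Q M] [AddCommGroup M']
    [Module Q M'] [AddCommGroup X] [Module Q X] (I : Ideal Q) (hX : ∀ r ∈ I, ∀ x : X, r • x = 0)
    (p : M →ₗ[Q] M') (hp : Function.Surjective p)
    (hker : LinearMap.ker p ≤ I • (⊤ : Submodule Q M)) :
    Function.Bijective (p.rTensor X) := by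
  refine ⟨?_, LinearMap.rTensor_surjective X hp⟩
  rw [injective_iff_map_eq_zero]
  intro t ht
  obtain ⟨s, rfl⟩ := (rTensor_exact X (LinearMap.exact_subtype_ker_map p) hp t).1 ht
  have hz : (LinearMap.ker p).subtype.rTensor X = 0 := by
    ext ⟨m, hm⟩ x
    have hm' := hker hm
    change m ⊗ₜ[Q] x = 0
    clear hm
    induction hm' using Submodule.smul_induction_on' with
    | smul r hr m _ => rw [TensorProduct.smul_tmul, hX r hr, TensorProduct.tmul_zero]
    | add a _ b _ ha hb => rw [TensorProduct.add_tmul, ha, hb, add_zero]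
  rw [hz, LinearMap.zero_apply]

lemma smul_eq_zero_of_mem_span {X : Type*} [AddCommGroup X] [Module Q X]
    (hX : ∀ x : X, f • x = 0) : ∀ r ∈ Ideal.span {f}, ∀ x : X, r • x = 0 := by
  intro r hr x
  obtain ⟨c, rfl⟩ := Ideal.mem_span_singleton'.1 hr
  rw [mul_smul, hX, smul_zero]

variable {X X' : Type u} [AddCommGroup X] [Module Q X] [AddCommGroup X'] [Module Q X']

lemma proj_rTensor_bijective (hX : ∀ x : X, f • x = 0) :
    Function.Bijective ((proj f n).rTensor X) := by
  refine rTensor_bijective (Ideal.span {f}) (smul_eq_zero_of_mem_span hX) _ proj_surjective ?_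
  intro q hq
  obtain ⟨q', rfl⟩ := (proj_eq_zero_iff q).1 hq
  exact Submodule.smul_mem_smul (Ideal.mem_span_singleton_self f) trivial

/-- Flatness of `Qⁿ` settles everything except surjectivity in degree zero. There the next map
`(Q/(g))ⁿ ⊗ X → Qⁿ ⊗ X` is multiplication by `f`, which is zero because `f` kills `X`. -/
lemma δ_bijective (h : AnnEq f g) (hX : ∀ x : X, f • x = 0) (i : ℕ) :
    Function.Bijective (δ (incl_injective h) (exact_incl_proj h.mul_eq_zero)
      (proj_surjective (f := f) (n := n)) X i) := by
  refine ⟨δ_injective _ _ _ _ _, ?_⟩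
  cases i with
  | succ i => exact δ_surjective_succ _ _ _ _ _
  | zero =>
    intro t
    refine (exact₁ _ _ _ X 0 t).1 ((zeroEquiv Q _ X).injective ?_)
    rw [zeroEquiv_mapLeft, map_zero]
    have hz : (incl f g n h.mul_eq_zero).rTensor X = 0 := by
      refine TensorProduct.ext' fun r x => ?_
      obtain ⟨q, rfl⟩ := proj_surjective r
      rw [LinearMap.rTensor_tmul, incl_proj, TensorProduct.smul_tmul, hX,
        TensorProduct.tmul_zero, LinearMap.zero_apply]
    rw [hz, LinearMap.zero_apply]

variable (n) in
/-- The tensor product of `(Q/(f))ⁿ` with a module killed by `f`. -/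
def torEquivZero (hf : ∀ x : X, f • x = 0) :
    TorRight Q 0 (Fin n → Q ⧸ Ideal.span {f}) X ≃ₗ[Q] (Fin n → Q) ⊗[Q] X :=
  LinearEquiv.trans (zeroEquiv Q (Fin n → Q ⧸ Ideal.span {f}) X)
    (LinearEquiv.ofBijective ((proj f n).rTensor X) (proj_rTensor_bijective hf)).symm

variable (n) in
/-- The connecting map as an isomorphism. -/
def torEquivShift (h : AnnEq f g) (hf : ∀ x : X, f • x = 0) (i : ℕ) :
    TorRight Q (i + 1) (Fin n → Q ⧸ Ideal.span {f}) X ≃ₗ[Q]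
      TorRight Q i (Fin n → Q ⧸ Ideal.span {g}) X :=
  LinearEquiv.ofBijective (δ (incl_injective h) (exact_incl_proj h.mul_eq_zero)
      (proj_surjective (f := f) (n := n)) X i) (δ_bijective h hf i)

variable (n X) in
/-- For an exact pair `(f, g)` and a module `X` killed by `f` and `g`, all the modules
`Tor_i(Q/(f)ⁿ, X)` are isomorphic to `Xⁿ`. -/
def torEquiv : ∀ (i : ℕ) {f g : Q} (_ : AnnEq f g) (_ : AnnEq g f)
    (_ : ∀ x : X, f • x = 0) (_ : ∀ x : X, g • x = 0),
    TorRight Q i (Fin n → Q ⧸ Ideal.span {f}) X ≃ₗ[Q] (Fin n → Q) ⊗[Q] X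
  | 0, _, _, _, _, hf, _ => torEquivZero n hf
  | i + 1, _, _, h, h', hf, hg => (torEquivShift n h hf i).trans (torEquiv i h' h hg hf)

lemma rTensor_torEquiv_zero (h : AnnEq f g) (h' : AnnEq g f) (hf : ∀ x : X, f • x = 0)
    (hg : ∀ x : X, g • x = 0) (t : TorRight Q 0 (Fin n → Q ⧸ Ideal.span {f}) X) :
    (proj f n).rTensor X (torEquiv n X 0 h h' hf hg t) = zeroEquiv Q _ X t :=
  (LinearEquiv.ofBijective ((proj f n).rTensor X) (proj_rTensor_bijective hf)).apply_symm_apply _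

lemma torEquiv_succ (h : AnnEq f g) (h' : AnnEq g f) (hf : ∀ x : X, f • x = 0)
    (hg : ∀ x : X, g • x = 0) (i : ℕ)
    (t : TorRight Q (i + 1) (Fin n → Q ⧸ Ideal.span {f}) X) :
    torEquiv n X (i + 1) h h' hf hg t =
      torEquiv n X i h' h hg hf (δ (incl_injective h) (exact_incl_proj h.mul_eq_zero)
        (proj_surjective (f := f) (n := n)) X i t) := rfl

lemma torEquiv_mapRight (φ : X →ₗ[Q] X') (i : ℕ) : ∀ {f g : Q} (h : AnnEq f g) (h' : AnnEq g f)
    (hf : ∀ x : X, f • x = 0) (hg : ∀ x : X, g • x = 0) (hf' : ∀ x : X', f • x = 0)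
    (hg' : ∀ x : X', g • x = 0) (t : TorRight Q i (Fin n → Q ⧸ Ideal.span {f}) X),
    torEquiv n X' i h h' hf' hg' (mapRight i _ φ t) =
      φ.lTensor _ (torEquiv n X i h h' hf hg t) := by
  induction i with
  | zero =>
    intro f g h h' hf hg hf' hg' t
    apply (proj_rTensor_bijective (n := n) hf').1
    rw [rTensor_torEquiv_zero, zeroEquiv_mapRight, ← LinearMap.comp_apply,
      LinearMap.rTensor_comp_lTensor, ← LinearMap.lTensor_comp_rTensor, LinearMap.comp_apply,
      rTensor_torEquiv_zero]
  | succ i ih =>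
    intro f g h h' hf hg hf' hg' t
    rw [torEquiv_succ, torEquiv_succ, ← δ_mapRight, ih]

lemma exists_lift_proj {s : ℕ} (u : (Fin s → Q) →ₗ[Q] (Fin n → Q)) (f : Q) :
    ∃ w : (Fin s → Q ⧸ Ideal.span {f}) →ₗ[Q] (Fin n → Q ⧸ Ideal.span {f}),
      w ∘ₗ proj f s = proj f n ∘ₗ u := by
  let e := (proj f s).quotKerEquivOfSurjective proj_surjective
  refine ⟨((LinearMap.ker (proj f s)).liftQ (proj f n ∘ₗ u) ?_) ∘ₗ e.symm.toLinearMap, ?_⟩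
  · intro q hq
    obtain ⟨q', rfl⟩ := (proj_eq_zero_iff q).1 hq
    rw [LinearMap.mem_ker, LinearMap.comp_apply, map_smul, proj_eq_zero_iff]
    exact ⟨_, rfl⟩
  · refine LinearMap.ext fun q => ?_
    have : e.symm (proj f s q) = Submodule.Quotient.mk q := e.symm_apply_eq.2 rfl
    simp only [LinearMap.comp_apply, LinearEquiv.coe_coe]
    rw [this]
    rfl

/-- One matrix `u` over `Q` reduces modulo both `f` and `g`, so it acts on the whole short exact
sequence. Hence its effect on Tor is `u ⊗ X` in every degree, and facts about degree zero carry over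
to all degrees. -/
lemma torEquiv_mapLeft {s : ℕ} (u : (Fin s → Q) →ₗ[Q] (Fin n → Q)) (i : ℕ) :
    ∀ {f g : Q} (h : AnnEq f g) (h' : AnnEq g f) (hf : ∀ x : X, f • x = 0)
    (hg : ∀ x : X, g • x = 0)
    (w : (Fin s → Q ⧸ Ideal.span {f}) →ₗ[Q] (Fin n → Q ⧸ Ideal.span {f}))
    (_ : w ∘ₗ proj f s = proj f n ∘ₗ u)
    (t : TorRight Q i (Fin s → Q ⧸ Ideal.span {f}) X),
    torEquiv n X i h h' hf hg (mapLeft i w X t) =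
      u.rTensor X (torEquiv s X i h h' hf hg t) := by
  induction i with
  | zero =>
    intro f g h h' hf hg w hw t
    apply (proj_rTensor_bijective (n := n) hf).1
    rw [rTensor_torEquiv_zero, zeroEquiv_mapLeft, ← LinearMap.comp_apply ((proj f n).rTensor X),
      ← LinearMap.rTensor_comp, ← hw, LinearMap.rTensor_comp, LinearMap.comp_apply,
      rTensor_torEquiv_zero]
  | succ i ih =>
    intro f g h h' hf hg w hw t
    obtain ⟨w', hw'⟩ := exists_lift_proj u g
    rw [torEquiv_succ, torEquiv_succ, ← ih h' h hg hf w' hw']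
    congr 1
    refine (δ_mapLeft _ _ _ _ _ _ w' u w ?_ hw.symm i t).symm
    refine LinearMap.ext fun r => ?_
    obtain ⟨q, rfl⟩ := proj_surjective r
    rw [LinearMap.comp_apply, LinearMap.comp_apply, incl_proj, ← LinearMap.comp_apply w', hw',
      LinearMap.comp_apply, incl_proj, map_smul]

end ExactPair

end

/-! ### Injectivity of `Tor(Q/(f), V) → Tor(k, V)` -/

noncomputable section

open TensorProduct TorRight

namespace ExactPair

open IsLocalRing KoszulNilpotence

variable {Q : Type u} [CommRing Q]

/-- The linear map from `Q/(f)` to the residue field. -/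
def residueQuot [IsLocalRing Q] {f : Q} (hf : f ∈ maximalIdeal Q) :
    (Q ⧸ Ideal.span {f}) →ₗ[Q] ResidueField Q :=
  Submodule.liftQ (Ideal.span {f}) (Algebra.linearMap Q (ResidueField Q)) (by
    rw [Ideal.span, Submodule.span_singleton_le_iff_mem, LinearMap.mem_ker,
      Algebra.linearMap_apply]
    exact (residue_eq_zero_iff f).2 hf)

/-- The linear map from `Q/(f)`, viewed as a space of vectors of length one, to the residue
field. -/
def residueVec [IsLocalRing Q] {f : Q} (hf : f ∈ maximalIdeal Q) :
    (Fin 1 → Q ⧸ Ideal.span {f}) →ₗ[Q] ResidueField Q :=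
  residueQuot hf ∘ₗ LinearMap.proj 0

lemma residueVec_proj [IsLocalRing Q] {f : Q} (hf : f ∈ maximalIdeal Q) (q : Fin 1 → Q) :
    residueVec hf (proj f 1 q) = residue Q (q 0) := rfl

/-- Elements outside `𝔪 X` are detected by linear maps to the residue field. -/
lemma exists_linearMap_residueField [IsLocalRing Q] {X : Type*} [AddCommGroup X] [Module Q X]
    (x : X) (hx : x ∉ maximalIdeal Q • (⊤ : Submodule Q X)) :
    ∃ η : X →ₗ[Q] ResidueField Q, η x = 1 := by
  let _ : Field (Q ⧸ maximalIdeal Q) := Ideal.Quotient.field _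
  have hw : (Submodule.Quotient.mk x : X ⧸ maximalIdeal Q • (⊤ : Submodule Q X)) ≠ 0 :=
    fun h => hx ((Submodule.Quotient.mk_eq_zero _).1 h)
  obtain ⟨η, hη⟩ := Module.Projective.exists_dual_eq_one (Q ⧸ maximalIdeal Q) hw
  let c : (Q ⧸ maximalIdeal Q) →ₗ[Q] ResidueField Q :=
    Submodule.liftQ (maximalIdeal Q) (Algebra.linearMap Q (ResidueField Q))
      fun q hq => (residue_eq_zero_iff q).2 hq
  refine ⟨c ∘ₗ η.restrictScalars Q ∘ₗ Submodule.mkQ _, ?_⟩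
  have h1 : c 1 = 1 := map_one (residue Q)
  rw [← h1, ← hη]
  rfl

section

variable {f g : Q} (h : AnnEq f g) {V : Type u} [AddCommGroup V] [Module Q V]
  {E : Type u} [AddCommGroup E] [Module Q E] (d : Module.Dual Q E)

variable (V) in
/-- The connecting map of `0 → Q/(g) → Q → Q/(f) → 0`. -/
def quotδ (i : ℕ) : TorRight Q (i + 1) (Fin 1 → Q ⧸ Ideal.span {f}) V →ₗ[Q]
    TorRight Q i (Fin 1 → Q ⧸ Ideal.span {g}) V :=
  δ (incl_injective h) (exact_incl_proj h.mul_eq_zero) proj_surjective V i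

lemma quotδ_injective (i : ℕ) : Function.Injective (quotδ h V i) :=
  δ_injective _ _ _ _ _

/-- Multiplication by `(g, 0)`, as a map from `Q/(f)` to the module of syzygies. -/
def mulSyzygy (hgf : g * f = 0) :
    (Fin 1 → Q ⧸ Ideal.span {f}) →ₗ[Q] LinearMap.ker (extendForm f d) :=
  LinearMap.codRestrict _ (LinearMap.inl Q Q E ∘ₗ LinearMap.proj 0 ∘ₗ incl g f 1 hgf) (by
    intro r
    obtain ⟨q, rfl⟩ := proj_surjective r
    rw [LinearMap.comp_apply, LinearMap.comp_apply, incl_proj, LinearMap.mem_ker]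
    simp [mul_right_comm g, hgf])

lemma mulSyzygy_proj (hgf : g * f = 0) (q : Fin 1 → Q) :
    mulSyzygy d hgf (proj f 1 q) = q 0 • mulSyzygy d hgf (proj f 1 fun _ => 1) := by
  rw [← map_smul, ← map_smul]
  congr 2
  ext l
  simp [Subsingleton.elim l 0]

lemma mulSyzygy_one (hgf : g * f = 0) :
    (mulSyzygy d hgf (proj f 1 fun _ => 1)).1 = (g, 0) := by
  change ((incl g f 1 hgf (proj f 1 fun _ => 1)) 0, (0 : E)) = (g, 0)
  rw [incl_proj]
  simp

end

section

variable [IsLocalRing Q] {f g : Q} (h : AnnEq f g) (h' : AnnEq g f) (hf : f ∈ maximalIdeal Q)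
  (hg : g ∈ maximalIdeal Q) {V : Type u} [AddCommGroup V] [Module Q V]

lemma residueVec_surjective : Function.Surjective (residueVec hf) := by
  intro x
  obtain ⟨q, rfl⟩ := residue_surjective x
  exact ⟨proj f 1 fun _ => q, rfl⟩

/-- The submodule inclusion of the maximal ideal, as the kernel in a short exact sequence. -/
lemma exact_maximalIdeal_residue :
    Function.Exact (maximalIdeal Q).subtype (Algebra.linearMap Q (ResidueField Q)) := by
  intro q
  rw [Algebra.linearMap_apply]
  refine (residue_eq_zero_iff q).trans ?_
  simp

/-- The kernel of `Q/(f) → k` is `𝔪 (Q/(f))`, which dies after tensoring with `V`. -/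
lemma mapLeft_residueVec_zero_injective (hV : ∀ r ∈ maximalIdeal Q, ∀ x : V, r • x = 0) :
    Function.Injective (mapLeft 0 (residueVec hf) V) := by
  have hb : Function.Injective ((residueVec hf).rTensor V) := by
    refine (rTensor_bijective (maximalIdeal Q) hV _ (residueVec_surjective hf) ?_).1
    intro r hr
    obtain ⟨q, rfl⟩ := proj_surjective r
    have hq : q 0 ∈ maximalIdeal Q := (residue_eq_zero_iff _).1 hr
    have : proj f 1 q = q 0 • proj f 1 (fun _ => 1) := by
      rw [← map_smul]
      congr 1
      ext l
      simp [Subsingleton.elim l 0]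
    rw [this]
    exact Submodule.smul_mem_smul hq trivial
  intro s t hst
  apply (zeroEquiv Q _ V).injective
  apply hb
  rw [← zeroEquiv_mapLeft, ← zeroEquiv_mapLeft, hst]

/-- Multiplication by `f`, as a map from `Q/(g)` to the maximal ideal. -/
def mulMaximalIdeal : (Fin 1 → Q ⧸ Ideal.span {g}) →ₗ[Q] maximalIdeal Q :=
  LinearMap.codRestrict (maximalIdeal Q) (LinearMap.proj 0 ∘ₗ incl f g 1 h.mul_eq_zero) (by
    intro r
    obtain ⟨q, rfl⟩ := proj_surjective r
    rw [LinearMap.comp_apply, incl_proj]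
    exact Ideal.mul_mem_right _ _ hf)

lemma mulMaximalIdeal_proj (q : Fin 1 → Q) :
    mulMaximalIdeal h hf (proj g 1 q) = q 0 • (⟨f, hf⟩ : maximalIdeal Q) :=
  Subtype.ext rfl

lemma algebraLinearMap_residueField_surjective :
    Function.Surjective (Algebra.linearMap Q (ResidueField Q)) :=
  residue_surjective

variable (Q V) in
/-- The connecting map of `0 → 𝔪 → Q → k → 0`. -/
def residueδ (i : ℕ) : TorRight Q (i + 1) (ResidueField Q) V →ₗ[Q]
    TorRight Q i (maximalIdeal Q) V :=
  δ (maximalIdeal Q).injective_subtype exact_maximalIdeal_residue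
    algebraLinearMap_residueField_surjective V i

/-- Naturality for the ladder from `0 → Q/(g) → Q → Q/(f) → 0` to `0 → 𝔪 → Q → k → 0` which is the
identity on `Q`. -/
lemma residueδ_mapLeft (i : ℕ) (t : TorRight Q (i + 1) (Fin 1 → Q ⧸ Ideal.span {f}) V) :
    mapLeft i (mulMaximalIdeal h hf) V (quotδ h V i t) =
      residueδ Q V i (mapLeft (i + 1) (residueVec hf) V t) := by
  have h₁ : (maximalIdeal Q).subtype ∘ₗ mulMaximalIdeal h hf =
    LinearMap.proj 0 ∘ₗ incl f g 1 h.mul_eq_zero := rfl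
  have h₂ : Algebra.linearMap Q (ResidueField Q) ∘ₗ LinearMap.proj 0 =
    residueVec hf ∘ₗ proj f 1 := rfl
  exact δ_mapLeft (incl_injective h) (exact_incl_proj h.mul_eq_zero) proj_surjective
    (maximalIdeal Q).injective_subtype exact_maximalIdeal_residue
    algebraLinearMap_residueField_surjective (mulMaximalIdeal h hf) (LinearMap.proj 0)
    (residueVec hf) h₁ h₂ i t

/-- As `f ∉ 𝔪²`, some `η : 𝔪 → k` sends `f` to `1`. Then `Q/(g) → 𝔪 → k` is the residue map, and the
connecting maps reduce the claim to degree zero for `g`. -/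
lemma mapLeft_residueVec_one_injective (h : AnnEq f g) (hg : g ∈ maximalIdeal Q) (hf₂ : f ∉ maximalIdeal Q ^ 2)
    (hV : ∀ r ∈ maximalIdeal Q, ∀ x : V, r • x = 0) :
    Function.Injective (mapLeft 1 (residueVec hf) V) := by
  have hf₂' : (⟨f, hf⟩ : maximalIdeal Q) ∉
      maximalIdeal Q • (⊤ : Submodule Q (maximalIdeal Q)) := by
    intro hmem
    apply hf₂
    have := Submodule.mem_map_of_mem (f := (maximalIdeal Q).subtype) hmem
    rw [Submodule.map_smul'', Submodule.map_top, Submodule.range_subtype, smul_eq_mul,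
      ← pow_two] at this
    exact this
  obtain ⟨η, hη⟩ := exists_linearMap_residueField _ hf₂'
  have hcomp : η ∘ₗ mulMaximalIdeal h hf = residueVec hg := by
    refine LinearMap.ext fun r => ?_
    obtain ⟨q, rfl⟩ := proj_surjective r
    rw [LinearMap.comp_apply, mulMaximalIdeal_proj, map_smul, hη, residueVec_proj,
      Algebra.smul_def, mul_one]
    rfl
  intro s t hst
  apply quotδ_injective h
  apply mapLeft_residueVec_zero_injective hg hV
  rw [← hcomp, ← mapLeft_mapLeft, ← mapLeft_mapLeft, residueδ_mapLeft, residueδ_mapLeft, hst]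

end

section

variable [IsLocalRing Q] {f g : Q} {E : Type u} [AddCommGroup E] [Module Q E]
  (d : Module.Dual Q E) (hf : f ∈ maximalIdeal Q) (hd : ∀ v, d v ∈ maximalIdeal Q)

/-- A presentation of the maximal ideal by `Q × E`. -/
def presentation : Q × E →ₗ[Q] maximalIdeal Q :=
  LinearMap.codRestrict (maximalIdeal Q) (extendForm f d) fun x =>
    add_mem (Ideal.mul_mem_left _ _ hf) (hd x.2)

lemma presentation_surjective (hI : ∀ r ∈ maximalIdeal Q, ∃ q x, r = q * f + d x) :
    Function.Surjective (presentation d hf hd) := by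
  rintro ⟨r, hr⟩
  obtain ⟨q, x, rfl⟩ := hI r hr
  exact ⟨(q, x), rfl⟩

lemma exact_presentation :
    Function.Exact (LinearMap.ker (extendForm f d)).subtype (presentation d hf hd) := by
  rw [LinearMap.exact_iff, Submodule.range_subtype]
  exact LinearMap.ker_codRestrict _ _ _

variable {V : Type u} [AddCommGroup V] [Module Q V]

variable (V) in
/-- The connecting map of `0 → Z → Q × E → 𝔪 → 0`. -/
def presentationδ (hI : ∀ r ∈ maximalIdeal Q, ∃ q x, r = q * f + d x) (i : ℕ) :
    TorRight Q (i + 1) (maximalIdeal Q) V →ₗ[Q]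
      TorRight Q i (LinearMap.ker (extendForm f d)) V :=
  δ (LinearMap.ker (extendForm f d)).injective_subtype (exact_presentation d hf hd)
    (presentation_surjective d hf hd hI) V i

/-- Naturality for the ladder from `0 → Q/(f) → Q → Q/(g) → 0` to `0 → Z → Q × E → 𝔪 → 0` with
middle map `q ↦ (q, 0)`. -/
lemma presentationδ_mapLeft (h : AnnEq f g) (h' : AnnEq g f)
    (hI : ∀ r ∈ maximalIdeal Q, ∃ q x, r = q * f + d x) (i : ℕ)
    (t : TorRight Q (i + 1) (Fin 1 → Q ⧸ Ideal.span {g}) V) :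
    mapLeft i (mulSyzygy d h'.mul_eq_zero) V (quotδ h' V i t) =
      presentationδ d hf hd V hI i (mapLeft (i + 1) (mulMaximalIdeal h hf) V t) := by
  have h₁ : (LinearMap.ker (extendForm f d)).subtype ∘ₗ mulSyzygy d h'.mul_eq_zero =
    (LinearMap.inl Q Q E ∘ₗ LinearMap.proj 0) ∘ₗ incl g f 1 h'.mul_eq_zero := rfl
  have h₂ : presentation d hf hd ∘ₗ (LinearMap.inl Q Q E ∘ₗ LinearMap.proj 0) =
      mulMaximalIdeal h hf ∘ₗ proj g 1 := by
    refine LinearMap.ext fun q => Subtype.ext ?_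
    change q 0 * f + d 0 = q 0 * f
    rw [map_zero, add_zero]
  exact δ_mapLeft (incl_injective h') (exact_incl_proj h'.mul_eq_zero) proj_surjective
    (LinearMap.ker (extendForm f d)).injective_subtype (exact_presentation d hf hd)
    (presentation_surjective d hf hd hI) (mulSyzygy d h'.mul_eq_zero)
    (LinearMap.inl Q Q E ∘ₗ LinearMap.proj 0) (mulMaximalIdeal h hf) h₁ h₂ i t

lemma mapLeft_residueVec_injective [Module.Free Q (ExteriorAlgebra Q E)]
    (hQ : ∀ j : ℕ, IsUnit ((j + 1 : ℕ) : Q)) (h : AnnEq f g) (h' : AnnEq g f)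
    (hf₂ : f ∉ maximalIdeal Q ^ 2) (hg : g ∈ maximalIdeal Q)
    (hI : ∀ r ∈ maximalIdeal Q, ∃ q x, r = q * f + d x) (hd : ∀ v, d v ∈ maximalIdeal Q)
    (hV : ∀ r ∈ maximalIdeal Q, ∀ x : V, r • x = 0) (i : ℕ) :
    Function.Injective (mapLeft i (residueVec hf) V) := by
  induction i using Nat.twoStepInduction with
  | zero => exact mapLeft_residueVec_zero_injective hf hV
  | one => exact mapLeft_residueVec_one_injective hf h hg hf₂ hV
  | more i ih _ =>
    have hz := syzygy_notMem_smul d (fun q => (h q).1) (fun q => (h' q).1) hQ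
      (IsLocalRing.maximalIdeal.isMaximal Q).ne_top hf hd hI
      (congrArg Prod.fst (mulSyzygy_one d h'.mul_eq_zero))
      (congrArg Prod.snd (mulSyzygy_one d h'.mul_eq_zero))
    obtain ⟨η, hη⟩ := exists_linearMap_residueField _ hz
    have hcomp : η ∘ₗ mulSyzygy d h'.mul_eq_zero = residueVec hf := by
      refine LinearMap.ext fun r => ?_
      obtain ⟨q, rfl⟩ := proj_surjective r
      rw [LinearMap.comp_apply, mulSyzygy_proj, map_smul, hη, residueVec_proj,
        Algebra.smul_def, mul_one]
      rfl
    intro s t hst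
    apply quotδ_injective h
    apply quotδ_injective h'
    -- Two connecting maps have brought degree `i + 2` for `Q/(f)` down to degree `i`. There the
    -- residue map factors through the syzygy module as `η` after `1 ↦ (g, 0)`, and the ladders lead
    -- back to `Tor_{i+2}(k, V)`.
    apply ih
    rw [← hcomp, ← mapLeft_mapLeft, ← mapLeft_mapLeft, presentationδ_mapLeft d hf hd h h' hI,
      presentationδ_mapLeft d hf hd h h' hI, residueδ_mapLeft, residueδ_mapLeft, hst]

end

section

variable {X : Type u} [AddCommGroup X] [Module Q X]

/-- Elements of `Tor_i(Q/(f)ⁿ, X)` are determined by their components. -/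
lemma eq_zero_of_components {f g : Q} (h : AnnEq f g) (h' : AnnEq g f)
    (hf : ∀ x : X, f • x = 0) (hg : ∀ x : X, g • x = 0) {n i : ℕ}
    (t : TorRight Q i (Fin n → Q ⧸ Ideal.span {f}) X)
    (ht : ∀ l : Fin n, mapLeft i
      (LinearMap.pi fun _ : Fin 1 => LinearMap.proj (R := Q) (φ := fun _ => Q ⧸ Ideal.span {f}) l)
      X t = 0) : t = 0 := by
  let p (l : Fin n) : (Fin n → Q) →ₗ[Q] (Fin 1 → Q) := LinearMap.pi fun _ => LinearMap.proj l
  let c (l : Fin n) : (Fin 1 → Q) →ₗ[Q] (Fin n → Q) :=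
    LinearMap.single Q (fun _ => Q) l ∘ₗ LinearMap.proj 0
  have hid : ∑ l, c l ∘ₗ p l = LinearMap.id := by
    refine LinearMap.ext fun q => funext fun l => ?_
    simp [c, p, LinearMap.sum_apply, Finset.sum_apply, Pi.single_apply]
  have h0 (l : Fin n) : (p l).rTensor X (torEquiv n X i h h' hf hg t) = 0 := by
    rw [← torEquiv_mapLeft (p l) i h h' hf hg (LinearMap.pi fun _ => LinearMap.proj l) rfl,
      ht, map_zero]
  apply (torEquiv n X i h h' hf hg).injective
  rw [map_zero, ← LinearMap.id_apply (R := Q) (torEquiv n X i h h' hf hg t),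
    ← LinearMap.rTensor_id, ← hid, ← LinearMap.coe_rTensorHom, map_sum, LinearMap.sum_apply]
  refine Finset.sum_eq_zero fun l _ => ?_
  rw [LinearMap.coe_rTensorHom, LinearMap.rTensor_comp, LinearMap.comp_apply, h0, map_zero]

end

/-- If `(f, g)` is an exact pair of zero divisors with `f ∉ 𝔪²`, then a map with image in
`𝔪 (Q/(f))ⁿ` induces the zero map on `Tor` with coefficients in a vector space. -/
theorem mapLeft_eq_zero [IsLocalRing Q] [IsNoetherianRing Q] [CharZero (ResidueField Q)]
    {f g : Q} (h : AnnEq f g) (h' : AnnEq g f) (hf : f ∈ maximalIdeal Q)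
    (hf₂ : f ∉ maximalIdeal Q ^ 2) (hg : g ∈ maximalIdeal Q) {n : ℕ} {M : Type u}
    [AddCommGroup M] [Module Q M] (j : M →ₗ[Q] (Fin n → Q ⧸ Ideal.span {f}))
    (hj : ∀ x l, residueQuot hf (j x l) = 0) {V : Type u} [AddCommGroup V] [Module Q V]
    (hV : ∀ r ∈ maximalIdeal Q, ∀ x : V, r • x = 0) (i : ℕ) (t : TorRight Q i M V) :
    mapLeft i j V t = 0 := by
  have hQ (j : ℕ) : IsUnit ((j + 1 : ℕ) : Q) := by
    by_contra hu
    have := (residue_eq_zero_iff _).2 ((mem_maximalIdeal _).2 hu)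
    rw [map_natCast, Nat.cast_eq_zero] at this
    exact absurd this (Nat.succ_ne_zero j)
  obtain ⟨e, a, ha⟩ := Submodule.fg_iff_exists_fin_generating_family.1
    (IsNoetherian.noetherian (maximalIdeal Q))
  let d : Module.Dual Q (Fin e → Q) := Fintype.linearCombination Q a
  have hd (v) : d v ∈ maximalIdeal Q := by
    rw [← ha, ← Fintype.range_linearCombination]
    exact ⟨v, rfl⟩
  have hI : ∀ r ∈ maximalIdeal Q, ∃ q x, r = q * f + d x := by
    intro r hr
    rw [← ha, ← Fintype.range_linearCombination] at hr
    obtain ⟨x, rfl⟩ := hr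
    -- The family `a` already generates `𝔪`, so `f` is a redundant extra generator with coefficient
    -- `0`; the presentation need not be minimal.
    exact ⟨0, x, by simp [d]⟩
  have : Module.Free Q (ExteriorAlgebra Q (Fin e → Q)) :=
    .of_basis (Pi.basisFun Q (Fin e)).ExteriorAlgebra
  refine eq_zero_of_components h h' (hV f hf) (hV g hg) _ fun l => ?_
  apply mapLeft_residueVec_injective d hf hQ h h' hf₂ hg hI hd hV i
  rw [mapLeft_mapLeft, mapLeft_mapLeft, map_zero]
  have : (residueVec hf ∘ₗ LinearMap.pi fun _ : Fin 1 =>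
      LinearMap.proj (R := Q) (φ := fun _ => Q ⧸ Ideal.span {f}) l) ∘ₗ j = 0 :=
    LinearMap.ext fun x => hj x l
  rw [this, mapLeft_zero]

end ExactPair

end

/-! ### Minimal presentations, lengths, and `Tor` of free modules as `Nⁿ` -/

noncomputable section

open TensorProduct TorRight

namespace ExactPair

open IsLocalRing

/-- `Aⁿ ⊗ X = Xⁿ`. -/
def evPi (A : Type*) [CommRing A] (n : ℕ) (X : Type*) [AddCommGroup X] [Module A X] :
    (Fin n → A) ⊗[A] X ≃ₗ[A] (Fin n → X) :=
  (TensorProduct.comm A (Fin n → A) X).trans (TensorProduct.piScalarRight A A X (Fin n))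

section

variable {A : Type*} [CommRing A] {n : ℕ} {X X' : Type*} [AddCommGroup X] [Module A X]
  [AddCommGroup X'] [Module A X']

lemma evPi_tmul (a : Fin n → A) (x : X) : evPi A n X (a ⊗ₜ x) = fun l => a l • x := by
  ext l
  simp [evPi]

lemma evPi_lTensor (φ : X →ₗ[A] X') (t : (Fin n → A) ⊗[A] X) (l : Fin n) :
    evPi A n X' (φ.lTensor _ t) l = φ (evPi A n X t l) := by
  induction t with
  | zero => simp
  | tmul a x => simp [evPi_tmul]
  | add s t hs ht => simp [hs, ht]

/-- A finitely generated module over a local ring has a minimal presentation. -/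
lemma exists_minimal_presentation [IsLocalRing A] (M : Type*) [AddCommGroup M] [Module A M]
    [Module.Finite A M] : ∃ (n : ℕ) (π : (Fin n → A) →ₗ[A] M), Function.Surjective π ∧
      ∀ r, π r = 0 → ∀ l, r l ∈ maximalIdeal A := by
  let b := Module.finBasis (ResidueField A) (ResidueField A ⊗[A] M)
  have hs : Function.Surjective (TensorProduct.mk A (ResidueField A) M 1) :=
    TensorProduct.mk_surjective A M (ResidueField A) residue_surjective
  choose m hm using fun i => hs (b i)
  refine ⟨_, Fintype.linearCombination A m, ?_, fun r hr l => ?_⟩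
  · rw [← LinearMap.range_eq_top, Fintype.range_linearCombination]
    exact span_eq_top_of_tmul_eq_basis m b hm
  · have h := congrArg (TensorProduct.mk A (ResidueField A) M 1) hr
    rw [Fintype.linearCombination_apply, map_sum, map_zero] at h
    simp only [map_smul, hm] at h
    have h' : ∑ i, residue A (r i) • b i = 0 := by
      rw [← h]
      exact Finset.sum_congr rfl fun i _ => algebraMap_smul (ResidueField A) (r i) (b i)
    exact (residue_eq_zero_iff _).1 (Fintype.linearIndependent_iff.1 b.linearIndependent _ h' l)

/-- Length is additive on the two images around an exact spot. -/
lemma length_eq_add_range {Y Z : Type*} [AddCommGroup Y] [Module A Y] [AddCommGroup Z] [Module A Z]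
    {a : X →ₗ[A] Y} {b : Y →ₗ[A] Z} (h : Function.Exact a b) :
    Module.length A Y = Module.length A (LinearMap.range a) +
      Module.length A (LinearMap.range b) := by
  refine Module.length_eq_add_of_exact (LinearMap.range a).subtype b.rangeRestrict
    (Submodule.injective_subtype _) b.surjective_rangeRestrict ?_
  rw [LinearMap.exact_iff, Submodule.range_subtype, LinearMap.ker_rangeRestrict]
  exact LinearMap.exact_iff.1 h

lemma length_range_eq_of_injective {Y : Type*} [AddCommGroup Y] [Module A Y] {a : X →ₗ[A] Y}
    (h : Function.Injective a) :
    Module.length A (LinearMap.range a) = Module.length A X :=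
  (LinearEquiv.ofInjective a h).length_eq.symm

lemma length_range_eq_of_surjective {Y : Type*} [AddCommGroup Y] [Module A Y] {a : X →ₗ[A] Y}
    (h : Function.Surjective a) :
    Module.length A (LinearMap.range a) = Module.length A Y := by
  rw [LinearMap.range_eq_top.2 h, Module.length_top]

lemma length_ne_top_of_smul_eq_zero [IsLocalRing A] [Module.Finite A X]
    (h : ∀ r ∈ maximalIdeal A, ∀ x : X, r • x = 0) : Module.length A X ≠ ⊤ := by
  let _ : Field (A ⧸ maximalIdeal A) := Ideal.Quotient.field _
  have ht : Module.IsTorsionBySet A X (maximalIdeal A : Set A) := fun x r => h r.1 r.2 x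
  let _ : Module (A ⧸ maximalIdeal A) X := ht.module
  have : IsScalarTower A (A ⧸ maximalIdeal A) X := ht.isScalarTower
  have : Module.Finite (A ⧸ maximalIdeal A) X := Module.Finite.of_restrictScalars_finite A _ _
  rw [Module.length_eq_of_surjective (R := A ⧸ maximalIdeal A) (Ideal.Quotient.mk_surjective),
    Module.length_eq_finrank]
  exact ENat.natCast_ne_top _

/-- Both `𝔪X` and `X/𝔪X` are finitely generated and killed by `𝔪`, hence finite-dimensional over the
residue field. -/
lemma length_ne_top_of_sq_smul [IsLocalRing A] [IsNoetherianRing A] [Module.Finite A X]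
    (h : maximalIdeal A ^ 2 • (⊤ : Submodule A X) = ⊥) : Module.length A X ≠ ⊤ := by
  let Y : Submodule A X := maximalIdeal A • ⊤
  rw [Module.length_eq_add_of_exact Y.subtype Y.mkQ Y.injective_subtype Y.mkQ_surjective
    (LinearMap.exact_subtype_mkQ Y)]
  refine WithTop.add_ne_top.2 ⟨length_ne_top_of_smul_eq_zero ?_, length_ne_top_of_smul_eq_zero ?_⟩
  · rintro r hr ⟨y, hy⟩
    refine Subtype.ext ?_
    have : r • y ∈ maximalIdeal A ^ 2 • (⊤ : Submodule A X) := by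
      rw [pow_two, ← smul_eq_mul, Submodule.smul_assoc]
      exact Submodule.smul_mem_smul hr hy
    rw [h] at this
    exact this
  · intro r hr y
    obtain ⟨x, rfl⟩ := Y.mkQ_surjective y
    rw [← map_smul]
    exact (Submodule.Quotient.mk_eq_zero _).2 (Submodule.smul_mem_smul hr trivial)

end

/-- The submodule `(I N)ⁿ` of `Nⁿ`. -/
def piSMul {A : Type*} [CommRing A] (I : Ideal A) (N : Type*) [AddCommGroup N] [Module A N] (n : ℕ) :
    Submodule A (Fin n → N) :=
  Submodule.pi Set.univ fun _ => I • ⊤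

lemma mem_piSMul {A : Type*} [CommRing A] {I : Ideal A} {N : Type*} [AddCommGroup N] [Module A N]
    {n : ℕ} {v : Fin n → N} : v ∈ piSMul I N n ↔ ∀ l, v l ∈ I • (⊤ : Submodule A N) := by
  simp [piSMul]

section

variable {Q : Type u} [CommRing Q] {f g : Q} {N : Type u} [AddCommGroup N] [Module Q N]

/-- The identification of `Tor_i(Q/(f)ⁿ, N)` with `Nⁿ`. -/
def torPiEquiv (h : AnnEq f g) (h' : AnnEq g f) (n i : ℕ) (hf : ∀ x : N, f • x = 0)
    (hg : ∀ x : N, g • x = 0) :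
    TorRight Q i (Fin n → Q ⧸ Ideal.span {f}) N ≃ₗ[Q] (Fin n → N) :=
  (torEquiv n N i h h' hf hg).trans (evPi Q n N)

variable (h : AnnEq f g) (h' : AnnEq g f) {n i : ℕ} {N' : Type u} [AddCommGroup N'] [Module Q N']
  (hf : ∀ x : N, f • x = 0) (hg : ∀ x : N, g • x = 0)
  (hf' : ∀ x : N', f • x = 0) (hg' : ∀ x : N', g • x = 0)

lemma torPiEquiv_mapRight (φ : N →ₗ[Q] N') (t : TorRight Q i (Fin n → Q ⧸ Ideal.span {f}) N)
    (l : Fin n) : torPiEquiv h h' n i hf' hg' (mapRight i _ φ t) l =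
      φ (torPiEquiv h h' n i hf hg t l) := by
  rw [torPiEquiv, torPiEquiv, LinearEquiv.trans_apply, LinearEquiv.trans_apply,
    torEquiv_mapRight φ i h h' hf hg hf' hg', evPi_lTensor]

lemma torPiEquiv_mapLeft {s : ℕ} (u : (Fin s → Q) →ₗ[Q] (Fin n → Q))
    (w : (Fin s → Q ⧸ Ideal.span {f}) →ₗ[Q] (Fin n → Q ⧸ Ideal.span {f}))
    (hw : w ∘ₗ proj f s = proj f n ∘ₗ u) (t : TorRight Q i (Fin s → Q ⧸ Ideal.span {f}) N) :
    torPiEquiv h h' n i hf hg (mapLeft i w N t) =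
      evPi Q n N (u.rTensor N (torEquiv s N i h h' hf hg t)) := by
  rw [torPiEquiv, LinearEquiv.trans_apply, torEquiv_mapLeft u i h h' hf hg w hw]

lemma mem_range_mapRight_iff (I : Ideal Q) (t : TorRight Q i (Fin n → Q ⧸ Ideal.span {f}) N) :
    t ∈ LinearMap.range (mapRight i (Fin n → Q ⧸ Ideal.span {f}) (idealInclusion I N)) ↔
      torPiEquiv h h' n i hf hg t ∈ piSMul I N n := by
  have hfI (x : (I • ⊤ : Submodule Q N)) : f • x = 0 := Subtype.ext (hf x)
  have hgI (x : (I • ⊤ : Submodule Q N)) : g • x = 0 := Subtype.ext (hg x)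
  rw [mem_piSMul]
  constructor
  · rintro ⟨t, rfl⟩ l
    rw [torPiEquiv_mapRight h h' hfI hgI hf hg]
    exact (torPiEquiv h h' n i hfI hgI t l).2
  · intro ht
    refine ⟨(torPiEquiv h h' n i hfI hgI).symm fun l => ⟨_, ht l⟩,
      (torPiEquiv h h' n i hf hg).injective (funext fun l => ?_)⟩
    rw [torPiEquiv_mapRight h h' hfI hgI hf hg, LinearEquiv.apply_symm_apply]
    rfl

lemma mapRight_mkQ_eq_zero_iff (I : Ideal Q) (t : TorRight Q i (Fin n → Q ⧸ Ideal.span {f}) N) :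
    mapRight i (Fin n → Q ⧸ Ideal.span {f}) (Submodule.mkQ (I • (⊤ : Submodule Q N))) t = 0 ↔
      torPiEquiv h h' n i hf hg t ∈ piSMul I N n := by
  have hfI (x : N ⧸ (I • ⊤ : Submodule Q N)) : f • x = 0 := by
    obtain ⟨x, rfl⟩ := Submodule.mkQ_surjective _ x
    rw [← map_smul, hf, map_zero]
  have hgI (x : N ⧸ (I • ⊤ : Submodule Q N)) : g • x = 0 := by
    obtain ⟨x, rfl⟩ := Submodule.mkQ_surjective _ x
    rw [← map_smul, hg, map_zero]
  rw [mem_piSMul, ← (torPiEquiv h h' n i hfI hgI).map_eq_zero_iff, funext_iff]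
  refine forall_congr' fun l => ?_
  rw [torPiEquiv_mapRight h h' hf hg hfI hgI]
  exact Submodule.Quotient.mk_eq_zero _

end

end ExactPair

end

/-! ### Consequences of the vanishing hypothesis over `R = Q/(f)` -/

noncomputable section

open TensorProduct TorRight

namespace ExactPair

open IsLocalRing

section

variable {Q : Type u} [CommRing Q] {f : Q}
  {M N : Type u} [AddCommGroup M] [AddCommGroup N]
  [Module (Q ⧸ Ideal.span {f}) M] [Module (Q ⧸ Ideal.span {f}) N] [Module Q N]
  [IsScalarTower Q (Q ⧸ Ideal.span {f}) N]
  {n : ℕ} {π : (Fin n → Q ⧸ Ideal.span {f}) →ₗ[Q ⧸ Ideal.span {f}] M}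

lemma mk_smul (q : Q) (x : N) : (Ideal.Quotient.mk (Ideal.span {f}) q) • x = q • x :=
  algebraMap_smul (Q ⧸ Ideal.span {f}) q x

lemma mem_map_smul_top {I : Ideal Q} {y : N} (hy : y ∈ I • (⊤ : Submodule Q N)) :
    y ∈ I.map (algebraMap Q (Q ⧸ Ideal.span {f})) •
      (⊤ : Submodule (Q ⧸ Ideal.span {f}) N) := by
  induction hy using Submodule.smul_induction_on' with
  | smul r hr x _ =>
    rw [← mk_smul (f := f)]
    exact Submodule.smul_mem_smul (Ideal.mem_map_of_mem _ hr) trivial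
  | add x _ y _ hx hy => exact add_mem hx hy

lemma length_eq_length (T : Type u) [AddCommGroup T] [Module (Q ⧸ Ideal.span {f}) T] [Module Q T]
    [IsScalarTower Q (Q ⧸ Ideal.span {f}) T] :
    Module.length (Q ⧸ Ideal.span {f}) T = Module.length Q T :=
  (Module.length_eq_of_surjective Ideal.Quotient.mk_surjective).symm

variable [IsLocalRing Q]

/-- The image of `ker π ⊗ N → Nⁿ`. -/
def kerTensorRange (π : (Fin n → Q ⧸ Ideal.span {f}) →ₗ[Q ⧸ Ideal.span {f}] M) (N : Type u)
    [AddCommGroup N] [Module (Q ⧸ Ideal.span {f}) N] :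
    Submodule (Q ⧸ Ideal.span {f}) (Fin n → N) :=
  LinearMap.range ((evPi (Q ⧸ Ideal.span {f}) n N).toLinearMap ∘ₗ
    (LinearMap.ker π).subtype.rTensor N)

lemma kerTensorRange_le (hπ' : ∀ r, π r = 0 → ∀ l, ∃ q ∈ maximalIdeal Q, r l = Ideal.Quotient.mk _ q)
    {v : Fin n → N} (hv : v ∈ kerTensorRange π N) : v ∈ piSMul (maximalIdeal Q) N n := by
  obtain ⟨t, rfl⟩ := hv
  rw [mem_piSMul]
  intro l
  induction t with
  | zero => simp
  | tmul r x =>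
    obtain ⟨q, hq, hr⟩ := hπ' r.1 r.2 l
    rw [LinearMap.comp_apply, LinearMap.rTensor_tmul, LinearEquiv.coe_coe, evPi_tmul]
    change r.1 l • x ∈ _
    rw [hr, mk_smul]
    exact Submodule.smul_mem_smul hq trivial
  | add s t hs ht =>
    rw [map_add]
    exact add_mem hs ht

/-- For `y ∈ 𝔪N`, the tensor `π(e_l) ⊗ y` comes from `M ⊗ 𝔪N` and so vanishes in `M ⊗ N`; right
exactness puts `e_l ⊗ y` in the image of `ker π ⊗ N`. -/
lemma le_kerTensorRange (hπ : Function.Surjective π)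
    (hM : ∀ t, mapRight (A := Q ⧸ Ideal.span {f}) 0 M (idealInclusion
      ((maximalIdeal Q).map (algebraMap Q (Q ⧸ Ideal.span {f}))) N) t = 0)
    {v : Fin n → N} (hv : v ∈ piSMul (maximalIdeal Q) N n) : v ∈ kerTensorRange π N := by
  rw [mem_piSMul] at hv
  rw [← Finset.univ_sum_single v]
  refine Submodule.sum_mem _ fun l _ => ?_
  let y : ((maximalIdeal Q).map (algebraMap Q (Q ⧸ Ideal.span {f})) •
      (⊤ : Submodule (Q ⧸ Ideal.span {f}) N) : Submodule _ N) := ⟨v l, mem_map_smul_top (hv l)⟩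
  let e : Fin n → Q ⧸ Ideal.span {f} := Pi.single l 1
  have h0 : π.rTensor N (e ⊗ₜ v l) = 0 := by
    have h := hM ((zeroEquiv _ _ _).symm (π e ⊗ₜ y))
    rw [← LinearEquiv.map_eq_zero_iff (zeroEquiv (Q ⧸ Ideal.span {f}) M N), zeroEquiv_mapRight,
      LinearEquiv.apply_symm_apply] at h
    exact h
  obtain ⟨t, ht⟩ := (rTensor_exact N (LinearMap.exact_subtype_ker_map π) hπ _).1 h0
  refine ⟨t, ?_⟩
  rw [LinearMap.comp_apply, ht, LinearEquiv.coe_coe, evPi_tmul]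
  ext k
  by_cases hk : k = l
  · subst hk
    simp [e]
  · simp [e, hk]

lemma length_kerTensorRange
    (hπ' : ∀ r, π r = 0 → ∀ l, ∃ q ∈ maximalIdeal Q, r l = Ideal.Quotient.mk _ q)
    (hπ : Function.Surjective π)
    (hM : ∀ t, mapRight (A := Q ⧸ Ideal.span {f}) 0 M (idealInclusion
      ((maximalIdeal Q).map (algebraMap Q (Q ⧸ Ideal.span {f}))) N) t = 0) :
    Module.length (Q ⧸ Ideal.span {f}) (kerTensorRange π N) =
      Module.length Q (piSMul (maximalIdeal Q) N n) := by
  have : (kerTensorRange π N).restrictScalars Q = piSMul (maximalIdeal Q) N n :=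
    Submodule.ext fun v => ⟨kerTensorRange_le hπ', le_kerTensorRange hπ hM⟩
  rw [length_eq_length, ← this]
  rfl

lemma length_range_mapLeft_zero
    (hπ' : ∀ r, π r = 0 → ∀ l, ∃ q ∈ maximalIdeal Q, r l = Ideal.Quotient.mk _ q)
    (hπ : Function.Surjective π)
    (hM : ∀ t, mapRight (A := Q ⧸ Ideal.span {f}) 0 M (idealInclusion
      ((maximalIdeal Q).map (algebraMap Q (Q ⧸ Ideal.span {f}))) N) t = 0) :
    Module.length (Q ⧸ Ideal.span {f}) (LinearMap.range
      (mapLeft (A := Q ⧸ Ideal.span {f}) 0 (LinearMap.ker π).subtype N)) =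
      Module.length Q (piSMul (maximalIdeal Q) N n) := by
  rw [← length_kerTensorRange hπ' hπ hM]
  let e := (zeroEquiv (Q ⧸ Ideal.span {f}) (Fin n → Q ⧸ Ideal.span {f}) N).trans
    (evPi (Q ⧸ Ideal.span {f}) n N)
  have he : kerTensorRange π N = (LinearMap.range
      (mapLeft (A := Q ⧸ Ideal.span {f}) 0 (LinearMap.ker π).subtype N)).map e.toLinearMap := by
    rw [← LinearMap.range_comp]
    have : e.toLinearMap ∘ₗ mapLeft (A := Q ⧸ Ideal.span {f}) 0 (LinearMap.ker π).subtype N =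
        ((evPi (Q ⧸ Ideal.span {f}) n N).toLinearMap ∘ₗ (LinearMap.ker π).subtype.rTensor N) ∘ₗ
          (zeroEquiv _ _ _).toLinearMap :=
      LinearMap.ext fun t => congrArg (evPi _ n N) (zeroEquiv_mapLeft _ t)
    rw [this, LinearMap.range_comp_of_range_eq_top _ (LinearEquiv.range _)]
    rfl
  rw [he]
  exact (e.submoduleMap _).length_eq

/-- The syzygy module inherits the vanishing hypothesis. -/
lemma mapRight_ker_eq_zero (hN : maximalIdeal Q ^ 2 • (⊤ : Submodule Q N) = ⊥)
    (hπ' : ∀ r, π r = 0 → ∀ l, ∃ q ∈ maximalIdeal Q, r l = Ideal.Quotient.mk _ q)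
    (hπ : Function.Surjective π)
    (hM : ∀ i t, mapRight (A := Q ⧸ Ideal.span {f}) i M (idealInclusion
      ((maximalIdeal Q).map (algebraMap Q (Q ⧸ Ideal.span {f}))) N) t = 0) (i : ℕ) (t) :
    mapRight (A := Q ⧸ Ideal.span {f}) i (LinearMap.ker π) (idealInclusion
      ((maximalIdeal Q).map (algebraMap Q (Q ⧸ Ideal.span {f}))) N) t = 0 := by
  set ν := idealInclusion ((maximalIdeal Q).map (algebraMap Q (Q ⧸ Ideal.span {f}))) N
  let hi := (LinearMap.ker π).injective_subtype
  let he := LinearMap.exact_subtype_ker_map π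
  -- By naturality it is enough that `δ` is onto. In degree zero this means that `K ⊗ 𝔪N → Rⁿ ⊗ 𝔪N`
  -- is zero, which holds since `K ⊆ 𝔪Rⁿ` and `𝔪²N = 0`.
  suffices ∃ t', δ hi he hπ _ i t' = t by
    obtain ⟨t', rfl⟩ := this
    rw [δ_mapRight, hM, map_zero]
  cases i with
  | succ i => exact δ_surjective_succ hi he hπ _ i t
  | zero =>
    refine (exact₁ hi he hπ _ 0 t).1 ?_
    apply (zeroEquiv _ _ _).injective
    rw [zeroEquiv_mapLeft, map_zero]
    generalize zeroEquiv _ _ _ t = z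
    apply (evPi _ n _).injective
    rw [map_zero]
    induction z with
    | zero => simp
    | add a b ha hb => rw [map_add, map_add, ha, hb, add_zero]
    | tmul r y =>
      rw [LinearMap.rTensor_tmul, evPi_tmul]
      ext l
      obtain ⟨q, hq, hr⟩ := hπ' r.1 r.2 l
      change r.1 l • y.1 = 0
      rw [hr, mk_smul]
      obtain ⟨y, hy⟩ := y
      have hy' : y ∈ maximalIdeal Q • (⊤ : Submodule Q N) := by
        induction hy using Submodule.smul_induction_on' with
        | add x _ y _ hx hy => exact add_mem hx hy
        | smul r hr x _ =>
          obtain ⟨q, hq, rfl⟩ := (Ideal.mem_map_iff_of_surjective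
            (algebraMap Q (Q ⧸ Ideal.span {f})) Ideal.Quotient.mk_surjective).1 hr
          rw [algebraMap_smul]
          exact Submodule.smul_mem_smul hq trivial
      have : q • y ∈ maximalIdeal Q ^ 2 • (⊤ : Submodule Q N) := by
        rw [pow_two, ← smul_eq_mul, Submodule.smul_assoc]
        exact Submodule.smul_mem_smul hq hy'
      rwa [hN] at this

end

end ExactPair

end

/-! ### The image of `Tor^Q(K, N)` in `Nⁿ`, and the inductive steps -/

noncomputable section

open TensorProduct TorRight

namespace ExactPair

open IsLocalRing

lemma smul_mkQ_eq_zero {Q : Type*} [CommRing Q] [IsLocalRing Q] {N : Type*} [AddCommGroup N]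
    [Module Q N] (r : Q) (hr : r ∈ maximalIdeal Q)
    (x : N ⧸ (maximalIdeal Q • ⊤ : Submodule Q N)) : r • x = 0 := by
  obtain ⟨x, rfl⟩ := Submodule.mkQ_surjective _ x
  rw [← map_smul]
  exact (Submodule.Quotient.mk_eq_zero _).2 (Submodule.smul_mem_smul hr trivial)

section

/-- The hypotheses on the exact pair `(f, g)`: each generates the annihilator of the other, both
lie in the maximal ideal, and `f` is a minimal generator of it. -/
structure IsMinimalPair {Q : Type u} [CommRing Q] [IsLocalRing Q] (f g : Q) : Prop where
  annEq : AnnEq f g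
  annEq' : AnnEq g f
  mem : f ∈ maximalIdeal Q
  notMem : f ∉ maximalIdeal Q ^ 2
  mem' : g ∈ maximalIdeal Q

/-- A minimal presentation `π` of a module `M` for which `M ⊗ 𝔪 N → M ⊗ N` vanishes. -/
structure IsAdapted {Q : Type u} [CommRing Q] [IsLocalRing Q] {f : Q} {M : Type u} (N : Type u)
    [AddCommGroup M] [AddCommGroup N] [Module (Q ⧸ Ideal.span {f}) M]
    [Module (Q ⧸ Ideal.span {f}) N] {n : ℕ}
    (π : (Fin n → Q ⧸ Ideal.span {f}) →ₗ[Q ⧸ Ideal.span {f}] M) : Prop where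
  surjective : Function.Surjective π
  minimal : ∀ r, π r = 0 → ∀ l, ∃ q ∈ maximalIdeal Q, r l = Ideal.Quotient.mk _ q
  vanishing : ∀ t, mapRight (A := Q ⧸ Ideal.span {f}) 0 M (idealInclusion
      ((maximalIdeal Q).map (algebraMap Q (Q ⧸ Ideal.span {f}))) N) t = 0

variable {Q : Type u} [CommRing Q] {f g : Q}
  {M N : Type u} [AddCommGroup M] [AddCommGroup N]
  [Module (Q ⧸ Ideal.span {f}) M] [Module (Q ⧸ Ideal.span {f}) N]
  {n : ℕ} {π : (Fin n → Q ⧸ Ideal.span {f}) →ₗ[Q ⧸ Ideal.span {f}] M}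

lemma length_torRight_quotient_succ (S : Function.Surjective π) (i : ℕ) :
    Module.length (Q ⧸ Ideal.span {f})
      (TorRight (Q ⧸ Ideal.span {f}) (i + 1) (LinearMap.ker π) N) =
    Module.length (Q ⧸ Ideal.span {f}) (TorRight (Q ⧸ Ideal.span {f}) (i + 1 + 1) M N) :=
  (LinearEquiv.ofBijective _ ⟨δ_injective (LinearMap.ker π).injective_subtype
    (LinearMap.exact_subtype_ker_map π) S N (i + 1), δ_surjective_succ _ _ _ N i⟩).length_eq.symm

variable [Module Q N] [IsScalarTower Q (Q ⧸ Ideal.span {f}) N]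

/-- The inclusion of `ker π`, as a `Q`-linear map. -/
abbrev kerInclusion (π : (Fin n → Q ⧸ Ideal.span {f}) →ₗ[Q ⧸ Ideal.span {f}] M) :
    LinearMap.ker π →ₗ[Q] (Fin n → Q ⧸ Ideal.span {f}) :=
  (LinearMap.ker π).subtype.restrictScalars Q

/-- The columns of `u` reduce modulo `f` to generators of `ker π`, and `f` acts as zero on `N`; so
the image of `ker π ⊗ N` in `Nⁿ` is already reached by a matrix over `Q`. -/
lemma exists_rTensor_eq {s : ℕ} {u : (Fin s → Q) →ₗ[Q] (Fin n → Q)}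
    {w : (Fin s → Q ⧸ Ideal.span {f}) →ₗ[Q] (Fin n → Q ⧸ Ideal.span {f})}
    (hw : w ∘ₗ proj f s = proj f n ∘ₗ u) (hker : ∀ r, π r = 0 → ∃ a, w a = r)
    {v : Fin n → N} (hv : v ∈ kerTensorRange π N) :
    ∃ z, evPi Q n N (u.rTensor N z) = v := by
  obtain ⟨t, rfl⟩ := hv
  induction t with
  | zero => exact ⟨0, by simp⟩
  | add a b ha hb =>
    obtain ⟨z, hz⟩ := ha
    obtain ⟨z', hz'⟩ := hb
    exact ⟨z + z', by rw [map_add, map_add, map_add, hz, hz']⟩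
  | tmul r x =>
    obtain ⟨a, ha⟩ := hker r.1 r.2
    obtain ⟨q, rfl⟩ := proj_surjective a
    refine ⟨q ⊗ₜ x, ?_⟩
    rw [LinearMap.rTensor_tmul, evPi_tmul, LinearMap.comp_apply, LinearMap.rTensor_tmul,
      LinearEquiv.coe_coe, evPi_tmul]
    ext l
    rw [← mk_smul (f := f)]
    have : Ideal.Quotient.mk (Ideal.span {f}) (u q l) = r.1 l := by
      rw [← ha]
      exact (congrFun (LinearMap.congr_fun hw q) l).symm
    rw [this]
    rfl

variable [IsLocalRing Q]

/-- The recursion for the lengths of `Tor` over `Q/(f)`, in degree zero. -/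
lemma length_torRight_quotient_zero (S : IsAdapted N π) :
    Module.length Q (Fin n → N) = Module.length Q (piSMul (maximalIdeal Q) N n) +
      Module.length (Q ⧸ Ideal.span {f}) (TorRight (Q ⧸ Ideal.span {f}) 0 M N) := by
  rw [← length_eq_length (f := f), ← ((zeroEquiv (Q ⧸ Ideal.span {f}) _ N).trans
      (evPi (Q ⧸ Ideal.span {f}) n N)).length_eq,
    length_eq_add_range (exact₂ (LinearMap.ker π).injective_subtype
      (LinearMap.exact_subtype_ker_map π) S.surjective N 0),
    length_range_eq_of_surjective (mapLeft_zero_surjective S.surjective),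
    length_range_mapLeft_zero S.minimal S.surjective S.vanishing]

lemma length_torRight_quotient_one (S : IsAdapted N π) :
    Module.length (Q ⧸ Ideal.span {f}) (TorRight (Q ⧸ Ideal.span {f}) 0 (LinearMap.ker π) N) =
      Module.length (Q ⧸ Ideal.span {f}) (TorRight (Q ⧸ Ideal.span {f}) 1 M N) +
        Module.length Q (piSMul (maximalIdeal Q) N n) := by
  rw [length_eq_add_range (exact₁ (LinearMap.ker π).injective_subtype
      (LinearMap.exact_subtype_ker_map π) S.surjective N 0),
    length_range_eq_of_injective (δ_injective _ _ S.surjective N 0),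
    length_range_mapLeft_zero S.minimal S.surjective S.vanishing]

variable [IsNoetherianRing Q] [CharZero (ResidueField Q)]

/-- Forward, the image dies in `Tor_i(Rⁿ, N/𝔪N)` by `mapLeft_eq_zero`. Backward, a free cover of
`ker π` lifted to a matrix over `Q` reduces every degree to the statement `le_kerTensorRange` about
degree zero. -/
lemma mem_range_mapLeft_kerInclusion_iff (H : IsMinimalPair f g) (S : IsAdapted N π)
    (hfN : ∀ x : N, f • x = 0) (hgN : ∀ x : N, g • x = 0) (i : ℕ)
    (t : TorRight Q i (Fin n → Q ⧸ Ideal.span {f}) N) :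
    t ∈ LinearMap.range (mapLeft i (kerInclusion π) N) ↔
      torPiEquiv H.annEq H.annEq' n i hfN hgN t ∈ piSMul (maximalIdeal Q) N n := by
  constructor
  · rintro ⟨t, rfl⟩
    rw [← mapRight_mkQ_eq_zero_iff, mapLeft_mapRight]
    refine mapLeft_eq_zero H.annEq H.annEq' H.mem H.notMem H.mem' _ (fun r l => ?_) smul_mkQ_eq_zero i _
    obtain ⟨q, hq, hr⟩ := S.minimal r.1 r.2 l
    change residueQuot H.mem (r.1 l) = 0
    rw [hr]
    exact (residue_eq_zero_iff q).2 hq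
  · intro ht
    obtain ⟨s, p, hp⟩ := Module.Finite.exists_fin' (Q ⧸ Ideal.span {f}) (LinearMap.ker π)
    let w := kerInclusion π ∘ₗ p.restrictScalars Q
    obtain ⟨u, hu⟩ := Module.projective_lifting_property (proj f n) (w ∘ₗ proj f s)
      proj_surjective
    obtain ⟨z, hz⟩ := exists_rTensor_eq (π := π) hu.symm (fun r hr => by
      obtain ⟨a, ha⟩ := hp ⟨r, hr⟩
      exact ⟨a, congrArg Subtype.val ha⟩) (le_kerTensorRange S.surjective S.vanishing ht)
    refine ⟨mapLeft i (p.restrictScalars Q) N ((torEquiv s N i H.annEq H.annEq' hfN hgN).symm z), ?_⟩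
    rw [mapLeft_mapLeft]
    apply (torPiEquiv H.annEq H.annEq' n i hfN hgN).injective
    rw [torPiEquiv_mapLeft H.annEq H.annEq' hfN hgN u w hu.symm, LinearEquiv.apply_symm_apply, hz]

lemma length_range_mapLeft_kerInclusion (H : IsMinimalPair f g) (S : IsAdapted N π)
    (hfN : ∀ x : N, f • x = 0) (hgN : ∀ x : N, g • x = 0) (i : ℕ) :
    Module.length Q (LinearMap.range (mapLeft i (kerInclusion π) N)) =
      Module.length Q (piSMul (maximalIdeal Q) N n) := by
  have : (LinearMap.range (mapLeft i (kerInclusion π) N)).map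
      (torPiEquiv H.annEq H.annEq' n i hfN hgN).toLinearMap = piSMul (maximalIdeal Q) N n := by
    ext v
    obtain ⟨t, rfl⟩ := (torPiEquiv H.annEq H.annEq' n i hfN hgN).surjective v
    rw [← mem_range_mapLeft_kerInclusion_iff H S]
    refine ⟨fun ⟨t', ht', e⟩ => ?_, fun ht => ⟨t, ht, rfl⟩⟩
    rwa [← (torPiEquiv H.annEq H.annEq' n i hfN hgN).injective e]
  rw [← this]
  exact ((torPiEquiv H.annEq H.annEq' n i hfN hgN).submoduleMap _).length_eq

variable [Module Q M] [IsScalarTower Q (Q ⧸ Ideal.span {f}) M]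

lemma mapLeft_eq_zero_of_mem (H : IsMinimalPair f g) (S : IsAdapted N π)
    (hfN : ∀ x : N, f • x = 0) (hgN : ∀ x : N, g • x = 0) (i : ℕ) (t : TorRight Q i (Fin n → Q ⧸ Ideal.span {f}) N)
    (ht : torPiEquiv H.annEq H.annEq' n i hfN hgN t ∈ piSMul (maximalIdeal Q) N n) :
    mapLeft i (π.restrictScalars Q) N t = 0 := by
  have he : Function.Exact (kerInclusion π) (π.restrictScalars Q) :=
    LinearMap.exact_subtype_ker_map π
  have hi : Function.Injective (kerInclusion π) := (LinearMap.ker π).injective_subtype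
  have hs : Function.Surjective (π.restrictScalars Q) := S.surjective
  exact (exact₂ hi he hs N i t).2
    ((mem_range_mapLeft_kerInclusion_iff H S hfN hgN i t).2 ht)

lemma mapRight_zero_eq_zero (H : IsMinimalPair f g) (S : IsAdapted N π)
    (hfN : ∀ x : N, f • x = 0) (hgN : ∀ x : N, g • x = 0) (t) :
    mapRight (A := Q) 0 M (idealInclusion (maximalIdeal Q) N) t = 0 := by
  obtain ⟨t, rfl⟩ := mapLeft_zero_surjective (g := π.restrictScalars Q) S.surjective t
  rw [mapLeft_mapRight]
  apply mapLeft_eq_zero_of_mem H S hfN hgN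
  exact (mem_range_mapRight_iff H.annEq H.annEq' hfN hgN _ _).1 ⟨t, rfl⟩

lemma mapRight_succ_eq_zero (H : IsMinimalPair f g) (S : IsAdapted N π)
    (hfN : ∀ x : N, f • x = 0) (hgN : ∀ x : N, g • x = 0) (i : ℕ)
    (ih : ∀ t, mapRight (A := Q) i (LinearMap.ker π) (idealInclusion (maximalIdeal Q) N) t = 0)
    (t) : mapRight (A := Q) (i + 1) M (idealInclusion (maximalIdeal Q) N) t = 0 := by
  have hi : Function.Injective (kerInclusion π) := (LinearMap.ker π).injective_subtype
  have he : Function.Exact (kerInclusion π) (π.restrictScalars Q) :=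
    LinearMap.exact_subtype_ker_map π
  have hs : Function.Surjective (π.restrictScalars Q) := S.surjective
  -- The vanishing for `K` in degree `i` lifts the image of `t` to some `y` in `Tor_{i+1}(Rⁿ, N)`.
  have h1 : δ hi he hs N i (mapRight (i + 1) M (idealInclusion (maximalIdeal Q) N) t) = 0 := by
    rw [← δ_mapRight, ih]
  obtain ⟨y, hy⟩ := (exact₃ hi he hs N i _).1 h1
  -- Modulo `𝔪N` the image of `t` is zero, so the class of `y` comes from `Tor_{i+1}(K, N/𝔪N)`,
  -- whose map to `Tor_{i+1}(Rⁿ, N/𝔪N)` is zero. Hence `y` lies in `(𝔪N)ⁿ`, which dies in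
  -- `Tor_{i+1}(M, N)`.
  have h2 : mapLeft (i + 1) (π.restrictScalars Q) _
      (mapRight (i + 1) (Fin n → Q ⧸ Ideal.span {f})
        (Submodule.mkQ (maximalIdeal Q • (⊤ : Submodule Q N))) y) = 0 := by
    have hc : (Submodule.mkQ (maximalIdeal Q • (⊤ : Submodule Q N))) ∘ₗ
        idealInclusion (maximalIdeal Q) N = 0 :=
      LinearMap.ext fun x => (Submodule.Quotient.mk_eq_zero _).2 x.2
    rw [← mapLeft_mapRight, hy, mapRight_mapRight, hc, mapRight_zero]
  obtain ⟨z, hz⟩ := (exact₂ hi he hs _ (i + 1) _).1 h2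
  rw [← hy]
  apply mapLeft_eq_zero_of_mem H S hfN hgN
  rw [← mapRight_mkQ_eq_zero_iff, ← hz]
  refine mapLeft_eq_zero H.annEq H.annEq' H.mem H.notMem H.mem' _ (fun r l => ?_) smul_mkQ_eq_zero _ _
  obtain ⟨q, hq, hr⟩ := S.minimal r.1 r.2 l
  change residueQuot H.mem (r.1 l) = 0
  rw [hr]
  exact (residue_eq_zero_iff q).2 hq

/-- The recursion for the lengths of `Tor` over `Q`, in degree zero. -/
lemma length_torRight_zero (H : IsMinimalPair f g) (S : IsAdapted N π)
    (hfN : ∀ x : N, f • x = 0) (hgN : ∀ x : N, g • x = 0) :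
    Module.length Q (Fin n → N) = Module.length Q (piSMul (maximalIdeal Q) N n) +
      Module.length Q (TorRight Q 0 M N) := by
  have he : Function.Exact (kerInclusion π) (π.restrictScalars Q) :=
    LinearMap.exact_subtype_ker_map π
  have hs : Function.Surjective (π.restrictScalars Q) := S.surjective
  have hi : Function.Injective (kerInclusion π) := (LinearMap.ker π).injective_subtype
  rw [← (torPiEquiv H.annEq H.annEq' n 0 hfN hgN).length_eq,
    length_eq_add_range (exact₂ hi he hs N 0),
    length_range_eq_of_surjective (mapLeft_zero_surjective hs),
    length_range_mapLeft_kerInclusion H S hfN hgN]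

/-- The recursion for the lengths of `Tor` over `Q`, in positive degrees. -/
lemma length_torRight_succ (H : IsMinimalPair f g) (S : IsAdapted N π)
    (hfN : ∀ x : N, f • x = 0) (hgN : ∀ x : N, g • x = 0) (i : ℕ) : ∃ a b,
    Module.length Q (Fin n → N) = Module.length Q (piSMul (maximalIdeal Q) N n) + a ∧
    Module.length Q (TorRight Q (i + 1) M N) = a + b ∧
    Module.length Q (TorRight Q i (LinearMap.ker π) N) =
      b + Module.length Q (piSMul (maximalIdeal Q) N n) := by
  have hi : Function.Injective (kerInclusion π) := (LinearMap.ker π).injective_subtype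
  have he : Function.Exact (kerInclusion π) (π.restrictScalars Q) :=
    LinearMap.exact_subtype_ker_map π
  have hs : Function.Surjective (π.restrictScalars Q) := S.surjective
  -- Here `a` is the length of the image of `Tor_{i+1}(Rⁿ, N) → Tor_{i+1}(M, N)` and `b` that of the
  -- image of the connecting map.
  refine ⟨_, _, ?_, length_eq_add_range (exact₃ hi he hs N i), ?_⟩
  · rw [← (torPiEquiv H.annEq H.annEq' n (i + 1) hfN hgN).length_eq,
      length_eq_add_range (exact₂ hi he hs N (i + 1)),
      length_range_mapLeft_kerInclusion H S hfN hgN]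
  · rw [length_eq_add_range (exact₁ hi he hs N i),
      length_range_mapLeft_kerInclusion H S hfN hgN]

end

end ExactPair

end

/-! ### Induction on the degree, and the transfer to `TorModule` -/

noncomputable section

open TensorProduct TorRight

namespace ExactPair

open IsLocalRing

section

variable {Q : Type u} [CommRing Q] [IsLocalRing Q] {f g : Q} {N : Type u} [AddCommGroup N]
  [Module (Q ⧸ Ideal.span {f}) N]

lemma exists_isAdapted (hf : f ∈ maximalIdeal Q) (M : Type u) [AddCommGroup M]
    [Module (Q ⧸ Ideal.span {f}) M] [Module.Finite (Q ⧸ Ideal.span {f}) M]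
    (hM : ∀ t, mapRight (A := Q ⧸ Ideal.span {f}) 0 M (idealInclusion
      ((maximalIdeal Q).map (algebraMap Q (Q ⧸ Ideal.span {f}))) N) t = 0) :
    ∃ (n : ℕ) (π : (Fin n → Q ⧸ Ideal.span {f}) →ₗ[Q ⧸ Ideal.span {f}] M), IsAdapted N π := by
  have : Nontrivial (Q ⧸ Ideal.span {f}) :=
    Ideal.Quotient.nontrivial_iff.2 (ne_top_of_le_ne_top (maximalIdeal.isMaximal Q).ne_top
      ((Ideal.span_singleton_le_iff_mem _).2 hf))
  have : IsLocalRing (Q ⧸ Ideal.span {f}) :=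
    .of_surjective' (Ideal.Quotient.mk _) Ideal.Quotient.mk_surjective
  obtain ⟨n, π, hπ, hπ'⟩ := exists_minimal_presentation (A := Q ⧸ Ideal.span {f}) M
  refine ⟨n, π, hπ, fun r hr l => ?_, hM⟩
  obtain ⟨q, hq⟩ := Ideal.Quotient.mk_surjective (r l)
  refine ⟨q, (mem_maximalIdeal q).2 fun hu => ?_, hq.symm⟩
  exact (mem_maximalIdeal _).1 (hπ' r hr l) (hq ▸ hu.map (Ideal.Quotient.mk (Ideal.span {f})))

variable [IsNoetherianRing Q] [CharZero (ResidueField Q)] [Module Q N]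
  [IsScalarTower Q (Q ⧸ Ideal.span {f}) N]

/-- The maps `Tor_i^Q(M, 𝔪 N) → Tor_i^Q(M, N)` vanish, and the length of `Tor_i^Q(M, N)` is finite,
and the sum of the lengths of `Tor_j^R(M, N)` for `j ≤ i`, where `R = Q/(f)`. -/
theorem mapRight_eq_zero_and_length (H : IsMinimalPair f g)
    (hN : maximalIdeal Q ^ 2 • (⊤ : Submodule Q N) = ⊥) (hfN : ∀ x : N, f • x = 0)
    (hgN : ∀ x : N, g • x = 0) [Module.Finite (Q ⧸ Ideal.span {f}) N] (i : ℕ) :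
    ∀ (M : Type u) [AddCommGroup M] [Module (Q ⧸ Ideal.span {f}) M] [Module Q M]
      [IsScalarTower Q (Q ⧸ Ideal.span {f}) M] [Module.Finite (Q ⧸ Ideal.span {f}) M],
      (∀ i t, mapRight (A := Q ⧸ Ideal.span {f}) i M (idealInclusion
        ((maximalIdeal Q).map (algebraMap Q (Q ⧸ Ideal.span {f}))) N) t = 0) →
      (∀ t, mapRight (A := Q) i M (idealInclusion (maximalIdeal Q) N) t = 0) ∧
      Module.length Q (TorRight Q i M N) ≠ ⊤ ∧
      Module.length Q (TorRight Q i M N) = ∑ j ∈ Finset.range (i + 1),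
        Module.length (Q ⧸ Ideal.span {f}) (TorRight (Q ⧸ Ideal.span {f}) j M N) := by
  have : Module.Finite Q N := Module.Finite.trans (Q ⧸ Ideal.span {f}) N
  have hJ (n : ℕ) : Module.length Q (Fin n → N) ≠ ⊤ := by
    rw [Module.length_pi_of_fintype, Finset.sum_const, nsmul_eq_mul]
    exact WithTop.mul_ne_top (ENat.natCast_ne_top _) (length_ne_top_of_sq_smul hN)
  induction i with
  | zero =>
    intro M _ _ _ _ _ hM
    obtain ⟨n, π, S⟩ := exists_isAdapted H.mem M (hM 0)
    have h1 := length_torRight_zero H S hfN hgN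
    have h2 := length_torRight_quotient_zero S
    have h3 := hJ n
    rw [h1] at h3 h2
    obtain ⟨hI, hq⟩ := WithTop.add_ne_top.1 h3
    refine ⟨mapRight_zero_eq_zero H S hfN hgN, hq, ?_⟩
    rw [Finset.sum_range_one]
    exact (ENat.add_right_injective_of_ne_top hI) h2
  | succ i ih =>
    intro M _ _ _ _ _ hM
    obtain ⟨n, π, S⟩ := exists_isAdapted H.mem M (hM 0)
    obtain ⟨ih1, ih2, ih3⟩ := ih (LinearMap.ker π) (mapRight_ker_eq_zero hN S.minimal S.surjective hM)
    obtain ⟨a, b, ha, hq, hb⟩ := length_torRight_succ H S hfN hgN i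
    have h2 := length_torRight_quotient_zero S
    have h3 := hJ n
    rw [ha] at h3 h2
    obtain ⟨hI, ha'⟩ := WithTop.add_ne_top.1 h3
    rw [hb] at ih2 ih3
    refine ⟨mapRight_succ_eq_zero H S hfN hgN i ih1, ?_, ?_⟩
    · rw [hq]
      exact WithTop.add_ne_top.2 ⟨ha', (WithTop.add_ne_top.1 ih2).1⟩
    -- The length of `(𝔪N)ⁿ` is finite and cancels twice: `a` becomes `ℓ Tor^R_0(M, N)`, and `b`
    -- becomes the sum of `ℓ Tor^R_j(M, N)` for `1 ≤ j ≤ i + 1`.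
    · rw [Finset.sum_range_succ', length_torRight_quotient_one S, ← add_assoc] at ih3
      rw [hq, Finset.sum_range_succ', Finset.sum_range_succ', ENat.add_right_injective_of_ne_top hI h2,
        ENat.add_left_injective_of_ne_top hI ih3, add_comm]
      simp only [length_torRight_quotient_succ S.surjective]

end

section

variable {A : Type u} [CommRing A] (M N : Type u) [AddCommGroup M] [Module A M] [AddCommGroup N]
  [Module A N]

lemma length_torModule (i : ℕ) :
    Module.length A (TorModule A i M N) = Module.length A (TorRight A i M N) := by
  obtain ⟨e, -⟩ := TorLES.exists_torModule_equiv (ModuleCat.of A M) i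
  exact (e (ModuleCat.of A N)).length_eq

lemma torMap_eq_zero_iff {N' : Type u} [AddCommGroup N'] [Module A N'] (φ : N →ₗ[A] N') (i : ℕ) :
    torMap A i M φ = 0 ↔ ∀ t, mapRight i M φ t = 0 := by
  obtain ⟨e, he⟩ := TorLES.exists_torModule_equiv (ModuleCat.of A M) i
  have he : ∀ x, e (ModuleCat.of A N') ((torMap A i M φ).hom x) =
    mapRight i M φ (e (ModuleCat.of A N) x) := he (ModuleCat.of A N) (ModuleCat.of A N') φ
  generalize torMap A i M φ = ψ at he ⊢
  generalize e (ModuleCat.of A N) = e₁ at he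
  generalize e (ModuleCat.of A N') = e₂ at he
  constructor
  · rintro rfl t
    obtain ⟨x, rfl⟩ := e₁.surjective t
    exact (he x).symm.trans (map_zero e₂)
  · intro h
    refine ModuleCat.hom_ext (LinearMap.ext fun x => e₂.injective ?_)
    exact ((he x).trans (h _)).trans (map_zero e₂).symm

end

end ExactPair

end

/-! ### The theorem -/

open ExactPair in
theorem mainTheorem6 {Q : Type u} [CommRing Q] [IsLocalRing Q] [IsNoetherianRing Q]
    [CharZero (IsLocalRing.ResidueField Q)]
    (f g : Q) (hfg : IsExactPair f g)
    (hf : f ∈ IsLocalRing.maximalIdeal Q) (hf' : f ∉ IsLocalRing.maximalIdeal Q ^ 2)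
    (M N : Type u) [AddCommGroup M] [AddCommGroup N]
    [Module (Q ⧸ Ideal.span {f}) M] [Module (Q ⧸ Ideal.span {f}) N]
    [Module Q M] [Module Q N]
    [IsScalarTower Q (Q ⧸ Ideal.span {f}) M] [IsScalarTower Q (Q ⧸ Ideal.span {f}) N]
    [Module.Finite (Q ⧸ Ideal.span {f}) M] [Module.Finite (Q ⧸ Ideal.span {f}) N]
    (hmN : IsLocalRing.maximalIdeal Q ^ 2 • (⊤ : Submodule Q N) = ⊥)
    (hgN : ∀ x : N, g • x = 0)
    (hTor : ∀ i : ℕ,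
      torMap (Q ⧸ Ideal.span {f}) i M
        (idealInclusion
          ((IsLocalRing.maximalIdeal Q).map (algebraMap Q (Q ⧸ Ideal.span {f}))) N) = 0) :
    (∀ i : ℕ, torMap Q i M (idealInclusion (IsLocalRing.maximalIdeal Q) N) = 0) ∧
    (∀ i : ℕ, Module.length Q (TorModule Q i M N) ≠ ⊤) ∧
    (∀ i : ℕ, Module.length (Q ⧸ Ideal.span {f})
      (TorModule (Q ⧸ Ideal.span {f}) i M N) ≠ ⊤) ∧
    poincareSeries Q M N =
      poincareSeries (Q ⧸ Ideal.span {f}) M N * (1 - PowerSeries.X)⁻¹ := by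
  have hg : g ∈ IsLocalRing.maximalIdeal Q := by
    -- If `g` were a unit, `f g = 0` would force `f = 0`.
    by_contra h
    have hu : IsUnit g := by simpa using h
    exact hfg.1 (hu.mul_left_eq_zero.1 (annEq_of_annihilator hfg.2.2.1).mul_eq_zero)
  have H : IsMinimalPair f g :=
    ⟨annEq_of_annihilator hfg.2.2.1, annEq_of_annihilator hfg.2.2.2, hf, hf', hg⟩
  have hfN (x : N) : f • x = 0 := by
    rw [← mk_smul (f := f), Ideal.Quotient.eq_zero_iff_mem.2 (Ideal.mem_span_singleton_self f),
      zero_smul]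
  have key (i : ℕ) := mapRight_eq_zero_and_length H hmN hfN hgN i M
    fun i => (torMap_eq_zero_iff _ _ _ i).1 (hTor i)
  simp only [torMap_eq_zero_iff, poincareSeries, length_torModule]
  have hR (i : ℕ) : Module.length (Q ⧸ Ideal.span {f})
      (TorRight (Q ⧸ Ideal.span {f}) i M N) ≠ ⊤ := by
    have h := (key i).2.1
    rw [(key i).2.2, Finset.sum_range_succ] at h
    exact (WithTop.add_ne_top.1 h).2
  refine ⟨fun i => (key i).1, fun i => (key i).2.1, hR, ?_⟩
  -- After multiplication by `1 - X` the claim is that consecutive lengths over `Q` differ by the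
  -- length over `R`; finiteness is needed because `toNat` is additive only on finite lengths.
  rw [PowerSeries.eq_mul_inv_iff_mul_eq (by simp)]
  ext i
  rw [mul_sub, mul_one, map_sub]
  cases i with
  | zero => simp [(key 0).2.2]
  | succ i =>
    rw [PowerSeries.coeff_succ_mul_X, PowerSeries.coeff_mk, PowerSeries.coeff_mk,
      PowerSeries.coeff_mk, (key (i + 1)).2.2, Finset.sum_range_succ, ← (key i).2.2,
      ENat.toNat_add (key i).2.1 (hR _)]
    push_cast
    ring
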